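/- For a finite simple undirected graph $G=(V,E)$ with vertex weights $w:V\to\mathbb{Z}^+$ let $$\mathrm{wvi}(G)=\min_{S\subseteq V}\Bigl(w(S)+\max_{D\in \mathrm{cc}(G-S)}w(D)\Bigr),$$ where $w(X)=\sum_{v\in X}w(v)$, $\mathrm{cc}(G-S)$ is the set of connected components of the graph $G-S$ induced on $V\setminus S$, and the maximum over the empty set is $0$. \textsc{Weighted Vertex Integrity} is the following problem: given $G$, the weights $w$ written in binary, and an integer $k$, decide whether $\mathrm{wvi}(G)\le k$. Let $\mathrm{vc}(G)$ be the minimum size of a vertex cover of $G$ (which is not part of the input), and let $n$ be the size of the input in bits. \textsc{Weighted Vertex Integrity} can be solved in time $2^{O(\mathrm{vc}(G))}\cdot n^{O(1)}$. That is, there are a program $p$ of a random access machine (with addition, truncated subtraction, halving, comparison and indirect addressing, under the logarithmic cost measure) and constants $A,c,d\in\mathbb{N}$ such that on every input $(G,w,k)$ the program $p$ halts after time at most $A\cdot 2^{c\cdot \mathrm{vc}(G)}\cdot n^{d}$ and answers correctly whether $\mathrm{wvi}(G)\le k$. -/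

import Mathlib

/-! ## Weighted vertex integrity -/

namespace WVI

/-- The weight `w(S)` of a set of vertices. -/
def weight {V : Type*} (w : V → ℕ+) (S : Finset V) : ℕ :=
  ∑ v ∈ S, (w v : ℕ)

/-- The graph `G - S`, induced on the complement of `S`. -/
abbrev deleteVerts {V : Type*} (G : SimpleGraph V) (S : Finset V) :
    SimpleGraph {v : V // v ∉ S} :=
  G.induce {v : V | v ∉ S}

/-- The vertices of a connected component of `G - S`, as a set of vertices of `G`. -/
noncomputable def componentVerts {V : Type*} [Fintype V] (G : SimpleGraph V) (S : Finset V)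
    (D : (deleteVerts G S).ConnectedComponent) : Finset V :=
  (Set.toFinite (Subtype.val '' D.supp)).toFinset

/-- `max_{D ∈ cc(G-S)} w(D)`; it is `0` when `G - S` has no vertex. -/
noncomputable def maxComponentWeight {V : Type*} [Fintype V] (G : SimpleGraph V) (w : V → ℕ+)
    (S : Finset V) : ℕ :=
  letI := Fintype.ofFinite (deleteVerts G S).ConnectedComponent
  Finset.univ.sup fun D : (deleteVerts G S).ConnectedComponent =>
    weight w (componentVerts G S D)

/-- The weighted vertex integrity `min_{S ⊆ V} (w(S) + max_{D ∈ cc(G-S)} w(D))`. -/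
noncomputable def wvi {V : Type*} [Fintype V] (G : SimpleGraph V) (w : V → ℕ+) : ℕ :=
  (Finset.univ : Finset (Finset V)).inf' Finset.univ_nonempty
    fun S => weight w S + maxComponentWeight G w S

/-- An instance of Weighted Vertex Integrity: a graph on the vertices `0, …, n - 1`,
positive integer vertex weights, and an integer `k`. -/
structure Instance where
  n : ℕ
  G : SimpleGraph (Fin n)
  w : Fin n → ℕ+
  k : ℤ

/-- The yes-instances. -/
def Instance.Yes (I : Instance) : Prop :=
  (wvi I.G I.w : ℤ) ≤ I.k

/-- The vertex cover number of the graph, as a natural number. -/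
noncomputable def Instance.vc (I : Instance) : ℕ :=
  I.G.vertexCoverNum.toNat

end WVI

/-! ## Random access machines with logarithmic cost -/

namespace RAM

/-- Length of the binary representation of a number, with one end marker. -/
def len (m : ℕ) : ℕ := m.size + 1

/-- Programs of a random access machine, with registers and arrays that hold natural numbers.
A program names finitely many registers and arrays; the arrays are unbounded. -/
inductive Prog where
  | skip : Prog
  /-- `r := c` -/
  | const (r c : ℕ) : Prog
  /-- `r := s` -/
  | copy (r s : ℕ) : Prog
  /-- `r := s + t` -/
  | add (r s t : ℕ) : Prog
  /-- `r := max (s - t) 0` -/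
  | sub (r s t : ℕ) : Prog
  /-- `r := ⌊s / 2⌋` -/
  | half (r s : ℕ) : Prog
  /-- `r := a[i]`, where the index is the content of register `i` -/
  | load (r a i : ℕ) : Prog
  /-- `a[i] := s`, where the index is the content of register `i` -/
  | store (a i s : ℕ) : Prog
  | seq (p q : Prog) : Prog
  /-- `if s < t then p else q` -/
  | ite (s t : ℕ) (p q : Prog) : Prog
  /-- `while s < t do p` -/
  | loop (s t : ℕ) (p : Prog) : Prog

/-- A memory state: the contents of the registers and of the arrays. -/
structure State where
  reg : ℕ → ℕ
  arr : ℕ → ℕ → ℕ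

/-- Write `m` into register `r`. -/
def State.setReg (σ : State) (r m : ℕ) : State :=
  { σ with reg := Function.update σ.reg r m }

/-- Write `m` into cell `i` of array `a`. -/
def State.setArr (σ : State) (a i m : ℕ) : State :=
  { σ with arr := Function.update σ.arr a (Function.update (σ.arr a) i m) }

/-- `Run p σ σ' t`: program `p`, started in state `σ`, halts in state `σ'` after time `t`.
Every executed operation and every executed test costs the total binary length of the numbers
(contents and array indices) that it handles. -/
inductive Run : Prog → State → State → ℕ → Prop where
  | skip (σ : State) : Run .skip σ σ 1
  | const (σ : State) (r c : ℕ) :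
      Run (.const r c) σ (σ.setReg r c) (len c)
  | copy (σ : State) (r s : ℕ) :
      Run (.copy r s) σ (σ.setReg r (σ.reg s)) (len (σ.reg s))
  | add (σ : State) (r s t : ℕ) :
      Run (.add r s t) σ (σ.setReg r (σ.reg s + σ.reg t)) (len (σ.reg s) + len (σ.reg t))
  | sub (σ : State) (r s t : ℕ) :
      Run (.sub r s t) σ (σ.setReg r (σ.reg s - σ.reg t)) (len (σ.reg s) + len (σ.reg t))
  | half (σ : State) (r s : ℕ) :
      Run (.half r s) σ (σ.setReg r (σ.reg s / 2)) (len (σ.reg s))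
  | load (σ : State) (r a i : ℕ) :
      Run (.load r a i) σ (σ.setReg r (σ.arr a (σ.reg i)))
        (len (σ.reg i) + len (σ.arr a (σ.reg i)))
  | store (σ : State) (a i s : ℕ) :
      Run (.store a i s) σ (σ.setArr a (σ.reg i) (σ.reg s)) (len (σ.reg i) + len (σ.reg s))
  | seq {p q : Prog} {σ σ' σ'' : State} {t t' : ℕ} :
      Run p σ σ' t → Run q σ' σ'' t' → Run (.seq p q) σ σ'' (t + t')
  | ite_true {x y : ℕ} {p q : Prog} {σ σ' : State} {t : ℕ} :
      σ.reg x < σ.reg y → Run p σ σ' t →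
      Run (.ite x y p q) σ σ' (len (σ.reg x) + len (σ.reg y) + t)
  | ite_false {x y : ℕ} {p q : Prog} {σ σ' : State} {t : ℕ} :
      ¬ σ.reg x < σ.reg y → Run q σ σ' t →
      Run (.ite x y p q) σ σ' (len (σ.reg x) + len (σ.reg y) + t)
  | loop_true {x y : ℕ} {p : Prog} {σ σ' σ'' : State} {t t' : ℕ} :
      σ.reg x < σ.reg y → Run p σ σ' t → Run (.loop x y p) σ' σ'' t' →
      Run (.loop x y p) σ σ'' (len (σ.reg x) + len (σ.reg y) + t + t')
  | loop_false {x y : ℕ} {p : Prog} {σ : State} :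
      ¬ σ.reg x < σ.reg y →
      Run (.loop x y p) σ σ (len (σ.reg x) + len (σ.reg y))

/-- On every instance `I`, given in memory as `input I`, program `p` halts within time `time I`,
with `1` in register `0` if `I` is a yes-instance and with `0` in register `0` if it is not. -/
def DecidesInTime {ι : Type*} (p : Prog) (input : ι → State) (yes : ι → Prop)
    (time : ι → ℕ) : Prop :=
  ∀ I : ι, ∃ (σ : State) (t : ℕ), Run p (input I) σ t ∧ t ≤ time I ∧
    (yes I → σ.reg 0 = 1) ∧ (¬ yes I → σ.reg 0 = 0)

end RAM

/-! ## Instances as inputs of a machine -/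

namespace WVI

open Classical in
/-- The input in memory: register `0` holds `n`, registers `1` and `2` hold `|k|` and the sign of
`k` (`1` if `k < 0`, else `0`), array `0` holds the weights, and array `1` holds the adjacency
matrix, with the entry for the vertices `i` and `j` in cell `n * i + j`. All else is `0`. -/
noncomputable def Instance.input (I : Instance) : RAM.State where
  reg r :=
    if r = 0 then I.n
    else if r = 1 then I.k.natAbs
    else if r = 2 then (if I.k < 0 then 1 else 0)
    else 0
  arr a m :=
    if a = 0 then (if h : m < I.n then (I.w ⟨m, h⟩ : ℕ) else 0)
    else if a = 1 then (if ∃ i j : Fin I.n, I.G.Adj i j ∧ m = I.n * i + j then 1 else 0)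
    else 0

/-- The size of the input in bits: the lengths of `n`, of `k` with its sign and of the weights,
all in binary, and the `n ^ 2` entries of the adjacency matrix. -/
def Instance.size (I : Instance) : ℕ :=
  RAM.len I.n + (RAM.len I.k.natAbs + 1) + ∑ v, RAM.len (I.w v) + I.n ^ 2

end WVI

/-! ## Unit cost runs -/

/-! Both ends of the edges of a maximal matching form a vertex cover `C`. It has `m ≤ 2 · vc`
vertices, because every vertex cover contains an end of each matching edge. The algorithm guesses
the set `Z ⊆ C` of cover vertices that are kept.

The components of `G - S` may be replaced by labels that are constant along the edges of `G - S`,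
with a bound `L` on the weight of every label class (`wvi_le_iff`). If a deleted vertex sees at most
one label, returning it with that label moves its weight from `w(S)` to `L` and leaves the sum
unchanged. So every deleted vertex may be assumed to see two labels (`exists_irredundant`). A vertex
outside `C` has all its neighbours in `C`, hence `Z` and the partition of `Z` into label classes
determine `S`: such a vertex is kept exactly if its neighbours in `Z` do not meet two classes. The
weight that belongs to a class `Q` then depends on `Z` and `Q` only; this is `gain`. Vertices
without neighbours in `Z` are always kept and form components of their own.

Minimising the deleted weight thus becomes maximising the total gain of disjoint subsets of `Z`,
each of gain at most a threshold. This is `Pack`, solved by dynamic programming over subsets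
(`packTable_den`). The weights are binary, so numerical thresholds cannot be enumerated; but the
gain of the heaviest class suffices as threshold, and it is one of `2 ^ m` values. `accept_iff` is
the resulting equivalence. The search consists of four nested loops over subsets of `C`, which gives
`2 ^ O(vc)`.

For the machine, steps are first counted at unit cost. A unit step lengthens the longest number by
at most one bit, so the logarithmic cost is polynomial in the number of steps and the input size
(`URun.run`). Programs are written in a language of counted loops whose meaning is a function on
states; `Cmd.compile_ev` transfers this meaning to the machine, and `Cmd.exists_cost_le` bounds the
steps polynomially in the loop bounds. -/

namespace RAM

/-- Runs under the unit cost measure: every operation and every test takes one step. -/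
inductive URun : Prog → State → State → ℕ → Prop where
  | skip (σ : State) : URun .skip σ σ 1
  | const (σ : State) (r c : ℕ) : URun (.const r c) σ (σ.setReg r c) 1
  | copy (σ : State) (r s : ℕ) : URun (.copy r s) σ (σ.setReg r (σ.reg s)) 1
  | add (σ : State) (r s t : ℕ) : URun (.add r s t) σ (σ.setReg r (σ.reg s + σ.reg t)) 1
  | sub (σ : State) (r s t : ℕ) : URun (.sub r s t) σ (σ.setReg r (σ.reg s - σ.reg t)) 1
  | half (σ : State) (r s : ℕ) : URun (.half r s) σ (σ.setReg r (σ.reg s / 2)) 1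
  | load (σ : State) (r a i : ℕ) : URun (.load r a i) σ (σ.setReg r (σ.arr a (σ.reg i))) 1
  | store (σ : State) (a i s : ℕ) : URun (.store a i s) σ (σ.setArr a (σ.reg i) (σ.reg s)) 1
  | seq {p q : Prog} {σ σ' σ'' : State} {t t' : ℕ} :
      URun p σ σ' t → URun q σ' σ'' t' → URun (.seq p q) σ σ'' (t + t')
  | ite_true {x y : ℕ} {p q : Prog} {σ σ' : State} {t : ℕ} :
      σ.reg x < σ.reg y → URun p σ σ' t → URun (.ite x y p q) σ σ' (1 + t)
  | ite_false {x y : ℕ} {p q : Prog} {σ σ' : State} {t : ℕ} :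
      ¬ σ.reg x < σ.reg y → URun q σ σ' t → URun (.ite x y p q) σ σ' (1 + t)
  | loop_true {x y : ℕ} {p : Prog} {σ σ' σ'' : State} {t t' : ℕ} :
      σ.reg x < σ.reg y → URun p σ σ' t → URun (.loop x y p) σ' σ'' t' →
      URun (.loop x y p) σ σ'' (1 + t + t')
  | loop_false {x y : ℕ} {p : Prog} {σ : State} :
      ¬ σ.reg x < σ.reg y → URun (.loop x y p) σ σ 1

/-- All contents of the memory are below `2 ^ b`. -/
def State.Below (b : ℕ) (σ : State) : Prop :=
  (∀ r, σ.reg r < 2 ^ b) ∧ ∀ a i, σ.arr a i < 2 ^ b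

/-- The largest constant of a program. -/
def Prog.maxConst : Prog → ℕ
  | .const _ c => c
  | .seq p q => max p.maxConst q.maxConst
  | .ite _ _ p q => max p.maxConst q.maxConst
  | .loop _ _ p => p.maxConst
  | _ => 0

theorem State.Below.mono {b b' : ℕ} {σ : State} (h : σ.Below b) (hb : b ≤ b') : σ.Below b' :=
  ⟨fun r => (h.1 r).trans_le (Nat.pow_le_pow_right two_pos hb),
    fun a i => (h.2 a i).trans_le (Nat.pow_le_pow_right two_pos hb)⟩

theorem State.Below.setReg {b : ℕ} {σ : State} (h : σ.Below b) {r m : ℕ} (hm : m < 2 ^ b) :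
    (σ.setReg r m).Below b := by
  refine ⟨fun x => ?_, h.2⟩
  by_cases hx : x = r
  · simpa [State.setReg, hx] using hm
  · simpa [State.setReg, hx] using h.1 x

theorem State.Below.setArr {b : ℕ} {σ : State} (h : σ.Below b) {a i m : ℕ} (hm : m < 2 ^ b) :
    (σ.setArr a i m).Below b := by
  refine ⟨h.1, fun x j => ?_⟩
  by_cases hx : x = a
  · subst hx
    by_cases hj : j = i
    · simpa [State.setArr, hj] using hm
    · simpa [State.setArr, hj] using h.2 x j
  · simpa [State.setArr, hx] using h.2 x j

theorem len_le {m b : ℕ} (h : m < 2 ^ b) : len m ≤ b + 1 :=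
  Nat.succ_le_succ (Nat.size_le.2 h)

/-- Every unit step at most doubles the largest number in memory, so that the logarithmic cost
is at most quadratic in the number of steps. -/
theorem URun.run {p : Prog} {σ σ' : State} {s : ℕ} (h : URun p σ σ' s) :
    ∀ b, σ.Below b → p.maxConst < 2 ^ b →
      σ'.Below (b + s) ∧ ∃ t, Run p σ σ' t ∧ t ≤ s * (2 * (b + s) + 2) := by
  induction h with
  | skip σ => exact fun b hσ _ => ⟨hσ.mono (by omega), 1, .skip _, by nlinarith⟩
  | const σ r c =>
    intro b hσ hc
    exact ⟨(hσ.setReg hc).mono (by omega), _, .const _ _ _, by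
      have := len_le hc; simp only [Prog.maxConst] at this; omega⟩
  | copy σ r x =>
    intro b hσ _
    exact ⟨(hσ.setReg (hσ.1 _)).mono (by omega), _, .copy _ _ _, by
      have := len_le (hσ.1 x); omega⟩
  | add σ r x y =>
    intro b hσ _
    have hx := hσ.1 x
    have hy := hσ.1 y
    refine ⟨(hσ.mono (Nat.le_succ b)).setReg ?_, _, .add _ _ _ _, by
      have := len_le hx; have := len_le hy; omega⟩
    rw [pow_succ]; omega
  | sub σ r x y =>
    intro b hσ _
    have hx := hσ.1 x
    have hy := hσ.1 y
    exact ⟨(hσ.setReg (by omega)).mono (by omega), _, .sub _ _ _ _, by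
      have := len_le hx; have := len_le hy; omega⟩
  | half σ r x =>
    intro b hσ _
    have hx := hσ.1 x
    exact ⟨(hσ.setReg (by omega)).mono (by omega), _, .half _ _ _, by
      have := len_le hx; omega⟩
  | load σ r a i =>
    intro b hσ _
    exact ⟨(hσ.setReg (hσ.2 _ _)).mono (by omega), _, .load _ _ _ _, by
      have := len_le (hσ.1 i); have := len_le (hσ.2 a (σ.reg i)); omega⟩
  | store σ a i x =>
    intro b hσ _
    exact ⟨(hσ.setArr (hσ.1 _)).mono (by omega), _, .store _ _ _ _, by
      have := len_le (hσ.1 i); have := len_le (hσ.1 x); omega⟩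
  | @seq p q σ σ' σ'' t t' _ _ ih ih' =>
    intro b hσ hc
    simp only [Prog.maxConst, max_lt_iff] at hc
    obtain ⟨h₁, u, hu, hut⟩ := ih b hσ hc.1
    -- After `t` steps the numbers are only known to be below `2 ^ (b + t)`, so the second part is
    -- estimated from there.
    obtain ⟨h₂, v, hv, hvt⟩ :=
      ih' (b + t) h₁ (hc.2.trans_le (Nat.pow_le_pow_right two_pos (by omega)))
    exact ⟨h₂.mono (by omega), _, .seq hu hv, by nlinarith⟩
  | @ite_true x y p q σ σ' t hxy _ ih =>
    intro b hσ hc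
    simp only [Prog.maxConst, max_lt_iff] at hc
    obtain ⟨h₁, u, hu, hut⟩ := ih b hσ hc.1
    exact ⟨h₁.mono (by omega), _, .ite_true hxy hu, by
      have := len_le (hσ.1 x); have := len_le (hσ.1 y); nlinarith⟩
  | @ite_false x y p q σ σ' t hxy _ ih =>
    intro b hσ hc
    simp only [Prog.maxConst, max_lt_iff] at hc
    obtain ⟨h₁, u, hu, hut⟩ := ih b hσ hc.2
    exact ⟨h₁.mono (by omega), _, .ite_false hxy hu, by
      have := len_le (hσ.1 x); have := len_le (hσ.1 y); nlinarith⟩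
  | @loop_true x y p σ σ' σ'' t t' hxy _ _ ih ih' =>
    intro b hσ hc
    obtain ⟨h₁, u, hu, hut⟩ := ih b hσ hc
    obtain ⟨h₂, v, hv, hvt⟩ :=
      ih' (b + t) h₁ (lt_of_lt_of_le hc (Nat.pow_le_pow_right two_pos (by omega)))
    exact ⟨h₂.mono (by omega), _, .loop_true hxy hu hv, by
      have := len_le (hσ.1 x); have := len_le (hσ.1 y); nlinarith⟩
  | @loop_false x y p σ hxy =>
    intro b hσ _
    exact ⟨hσ.mono (by omega), _, .loop_false hxy, by
      have := len_le (hσ.1 x); have := len_le (hσ.1 y); omega⟩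

/-! ### Total correctness with a bound on the number of unit steps -/

/-- Program `p`, started in `σ`, halts within `s` unit steps in a state with property `Q`. -/
def Ev (p : Prog) (σ : State) (s : ℕ) (Q : State → Prop) : Prop :=
  ∃ σ' s', URun p σ σ' s' ∧ s' ≤ s ∧ Q σ'

namespace Ev

variable {p q : Prog} {σ : State} {s s' : ℕ} {Q Q' : State → Prop}

theorem mono (h : Ev p σ s Q) (hs : s ≤ s') (hQ : ∀ τ, Q τ → Q' τ) : Ev p σ s' Q' := by
  obtain ⟨τ, t, h, ht, hq⟩ := h
  exact ⟨τ, t, h, ht.trans hs, hQ _ hq⟩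

theorem seq (h : Ev p σ s fun τ => Ev q τ s' Q) : Ev (.seq p q) σ (s + s') Q := by
  obtain ⟨τ, t, h, ht, τ', t', h', ht', hq⟩ := h
  exact ⟨τ', _, .seq h h', by omega, hq⟩

theorem skip (h : Q σ) : Ev .skip σ 1 Q := ⟨_, _, .skip _, le_rfl, h⟩

theorem const {r c : ℕ} (h : Q (σ.setReg r c)) : Ev (.const r c) σ 1 Q :=
  ⟨_, _, .const _ _ _, le_rfl, h⟩

theorem copy {r x : ℕ} (h : Q (σ.setReg r (σ.reg x))) : Ev (.copy r x) σ 1 Q :=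
  ⟨_, _, .copy _ _ _, le_rfl, h⟩

theorem add {r x y : ℕ} (h : Q (σ.setReg r (σ.reg x + σ.reg y))) : Ev (.add r x y) σ 1 Q :=
  ⟨_, _, .add _ _ _ _, le_rfl, h⟩

theorem sub {r x y : ℕ} (h : Q (σ.setReg r (σ.reg x - σ.reg y))) : Ev (.sub r x y) σ 1 Q :=
  ⟨_, _, .sub _ _ _ _, le_rfl, h⟩

theorem half {r x : ℕ} (h : Q (σ.setReg r (σ.reg x / 2))) : Ev (.half r x) σ 1 Q :=
  ⟨_, _, .half _ _ _, le_rfl, h⟩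

theorem load {r a i : ℕ} (h : Q (σ.setReg r (σ.arr a (σ.reg i)))) : Ev (.load r a i) σ 1 Q :=
  ⟨_, _, .load _ _ _ _, le_rfl, h⟩

theorem store {a i x : ℕ} (h : Q (σ.setArr a (σ.reg i) (σ.reg x))) : Ev (.store a i x) σ 1 Q :=
  ⟨_, _, .store _ _ _ _, le_rfl, h⟩

/-- Adding the costs of both branches, instead of taking the larger one, keeps all later bounds
polynomial expressions. -/
theorem ite {x y : ℕ} (h : σ.reg x < σ.reg y → Ev p σ s Q)
    (h' : ¬ σ.reg x < σ.reg y → Ev q σ s' Q) : Ev (.ite x y p q) σ (1 + (s + s')) Q := by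
  by_cases hxy : σ.reg x < σ.reg y
  · obtain ⟨τ, t, h, ht, hq⟩ := h hxy
    exact ⟨τ, _, .ite_true hxy h, by omega, hq⟩
  · obtain ⟨τ, t, h, ht, hq⟩ := h' hxy
    exact ⟨τ, _, .ite_false hxy h, by omega, hq⟩

/-- The rule for loops whose number of rounds is known beforehand. -/
theorem loop {x y N : ℕ} (Inv : ℕ → State → Prop) (h₀ : Inv 0 σ)
    (hlt : ∀ i τ, Inv i τ → (τ.reg x < τ.reg y ↔ i < N))
    (hstep : ∀ i τ, i < N → Inv i τ → Ev p τ s (Inv (i + 1))) :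
    Ev (.loop x y p) σ (N * (s + 1) + 1) (Inv N) := by
  suffices H : ∀ k i τ, i + k = N → Inv i τ → Ev (.loop x y p) τ (k * (s + 1) + 1) (Inv N) from
    H N 0 σ (zero_add N) h₀
  intro k
  induction k with
  | zero =>
    intro i τ hi h
    obtain rfl : i = N := by omega
    exact ⟨τ, 1, .loop_false (by simp [hlt _ _ h]), by omega, h⟩
  | succ k ih =>
    intro i τ hi h
    obtain ⟨τ', t, hr, ht, h'⟩ := hstep i τ (by omega) h
    obtain ⟨τ'', t', hr', ht', h''⟩ := ih (i + 1) τ' (by omega) h'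
    exact ⟨τ'', _, .loop_true ((hlt _ _ h).2 (by omega)) hr hr', by nlinarith, h''⟩

end Ev

end RAM

/-! ## A language with expressions and counted loops -/

namespace RAM

@[simp] theorem State.setReg_reg (σ : State) (r m x : ℕ) :
    (σ.setReg r m).reg x = if x = r then m else σ.reg x := by
  simp [State.setReg, Function.update_apply]

@[simp] theorem State.setReg_arr (σ : State) (r m : ℕ) : (σ.setReg r m).arr = σ.arr := rfl

@[simp] theorem State.setArr_reg (σ : State) (a i m : ℕ) : (σ.setArr a i m).reg = σ.reg := rfl

@[simp] theorem State.setArr_arr (σ : State) (a i m b j : ℕ) :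
    (σ.setArr a i m).arr b j = if b = a ∧ j = i then m else σ.arr b j := by
  by_cases hb : b = a
  · subst hb; simp [State.setArr, Function.update_apply]
  · simp [State.setArr, hb]

/-- Expressions. -/
inductive Ex where
  | reg (r : ℕ) : Ex
  | const (c : ℕ) : Ex
  | add (a b : Ex) : Ex
  | sub (a b : Ex) : Ex
  | load (a : ℕ) (e : Ex) : Ex
  /-- The bitwise conjunction of the lowest bits; their number is the content of register `5`. -/
  | land (a b : Ex) : Ex

/-- The value of an expression. -/
def Ex.den (σ : State) : Ex → ℕ
  | .reg r => σ.reg r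
  | .const c => c
  | .add a b => a.den σ + b.den σ
  | .sub a b => a.den σ - b.den σ
  | .load a e => σ.arr a (e.den σ)
  | .land a b => (a.den σ &&& b.den σ) % 2 ^ σ.reg 5

/-- One round of the computation of a bitwise conjunction of registers `d` and `d + 1`. -/
def landRound (d : ℕ) : Prog :=
  .seq (.half (d + 5) d) <| .seq (.add (d + 6) (d + 5) (d + 5)) <| .seq (.sub (d + 6) d (d + 6)) <|
  .seq (.copy d (d + 5)) <|
  .seq (.half (d + 5) (d + 1)) <| .seq (.add (d + 8) (d + 5) (d + 5)) <|
  .seq (.sub (d + 8) (d + 1) (d + 8)) <| .seq (.copy (d + 1) (d + 5)) <|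
  .seq (.add (d + 6) (d + 6) (d + 8)) <|
  .seq (.ite (d + 7) (d + 6) (.add (d + 2) (d + 2) (d + 3)) .skip) <|
  .seq (.add (d + 3) (d + 3) (d + 3)) (.add (d + 4) (d + 4) (d + 7))

/-- The bitwise conjunction of registers `d` and `d + 1`. -/
def landProg (d : ℕ) : Prog :=
  .seq (.const (d + 2) 0) <| .seq (.const (d + 3) 1) <| .seq (.const (d + 4) 0) <|
  .seq (.const (d + 7) 1) <| .seq (.loop (d + 4) 5 (landRound d)) (.copy d (d + 2))

/-- The program that evaluates an expression into register `d`, using the registers from `d` on. -/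
def Ex.compile (d : ℕ) : Ex → Prog
  | .reg r => .copy d r
  | .const c => .const d c
  | .add a b => .seq (a.compile d) (.seq (b.compile (d + 1)) (.add d d (d + 1)))
  | .sub a b => .seq (a.compile d) (.seq (b.compile (d + 1)) (.sub d d (d + 1)))
  | .load a e => .seq (e.compile d) (.load d a d)
  | .land a b => .seq (a.compile d) (.seq (b.compile (d + 1)) (landProg d))

/-- The expression uses only registers below `100`, and `land` only if register `5` is in `B`. -/
def Ex.ok (B : List ℕ) : Ex → Bool
  | .reg r => decide (r < 100)
  | .const _ => true
  | .add a b => a.ok B && b.ok B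
  | .sub a b => a.ok B && b.ok B
  | .load _ e => e.ok B
  | .land a b => B.contains 5 && (a.ok B && b.ok B)

/-- A bound on the number of steps of an evaluation, if the registers that bound loops contain
at most `N`. -/
def Ex.cost (N : ℕ) : Ex → ℕ
  | .reg _ => 1
  | .const _ => 1
  | .add a b => a.cost N + (b.cost N + 1)
  | .sub a b => a.cost N + (b.cost N + 1)
  | .load _ e => e.cost N + 1
  | .land a b => a.cost N + (b.cost N + (N * 15 + 6))

/-- The states agree, except for the scratch registers from `100` on. -/
def Sim (σ τ : State) : Prop := (∀ r < 100, τ.reg r = σ.reg r) ∧ τ.arr = σ.arr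

/-- Bit `i` of the conjunction is set exactly if the two bits sum to more than one. The machine can
test this form. -/
theorem land_mod_step (a b i : ℕ) :
    (a &&& b) % 2 ^ (i + 1) = (a &&& b) % 2 ^ i +
      if 1 < a / 2 ^ i % 2 + b / 2 ^ i % 2 then 2 ^ i else 0 := by
  rw [Nat.mod_pow_succ]
  congr 1
  have h : (a &&& b) / 2 ^ i % 2 = if 1 < a / 2 ^ i % 2 + b / 2 ^ i % 2 then 1 else 0 := by
    have := Nat.testBit_land a b i
    simp only [Nat.testBit_eq_decide_div_mod_eq] at this
    rcases Nat.mod_two_eq_zero_or_one (a / 2 ^ i) with ha | ha <;>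
    rcases Nat.mod_two_eq_zero_or_one (b / 2 ^ i) with hb | hb <;>
    simp_all
  rw [h]
  split_ifs <;> simp

/-- The loop peels off the lowest bits of both arguments and adds `2 ^ i` to the result when both
are set. The number of rounds is read from register `5`, which lies below the scratch registers and
therefore stays fixed. -/
theorem landProg_ev (d : ℕ) (hd : 100 ≤ d) (σ : State) :
    Ev (landProg d) σ (σ.reg 5 * 15 + 6) fun τ =>
      τ.reg d = (σ.reg d &&& σ.reg (d + 1)) % 2 ^ σ.reg 5 ∧
      (∀ r < d, τ.reg r = σ.reg r) ∧ τ.arr = σ.arr := by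
  have key : Ev (landProg d) σ (1 + (1 + (1 + (1 + ((σ.reg 5 * (14 + 1) + 1) + 1))))) fun τ =>
      τ.reg d = (σ.reg d &&& σ.reg (d + 1)) % 2 ^ σ.reg 5 ∧
      (∀ r < d, τ.reg r = σ.reg r) ∧ τ.arr = σ.arr := by
    refine .seq (.const (.seq (.const (.seq (.const (.seq (.const (.seq ?_))))))))
    refine Ev.mono (Ev.loop (N := σ.reg 5) (s := 14) (fun i τ =>
      τ.reg d = σ.reg d / 2 ^ i ∧ τ.reg (d + 1) = σ.reg (d + 1) / 2 ^ i ∧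
      τ.reg (d + 2) = (σ.reg d &&& σ.reg (d + 1)) % 2 ^ i ∧ τ.reg (d + 3) = 2 ^ i ∧
      τ.reg (d + 4) = i ∧ τ.reg (d + 7) = 1 ∧
      (∀ r < d, τ.reg r = σ.reg r) ∧ τ.arr = σ.arr) ?_ ?_ ?_) le_rfl ?_
    · refine ⟨by simp, by simp, by simp [Nat.mod_one], by simp, by simp, by simp, ?_, by simp⟩
      intro r hr
      have h2 : r ≠ d + 2 := by omega
      have h3 : r ≠ d + 3 := by omega
      have h4 : r ≠ d + 4 := by omega
      have h7 : r ≠ d + 7 := by omega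
      simp [h2, h3, h4, h7]
    · rintro i τ ⟨-, -, -, -, h4, -, hr, -⟩
      rw [h4, hr 5 (by omega)]
    · rintro i τ hi ⟨h0, h1, h2, h3, h4, h7, hr, ha⟩
      -- The unit steps of one round, bracketed as the rules for `seq` and `ite` produce them.
      have e : (14 : ℕ) = 1+(1+(1+(1+(1+(1+(1+(1+(1+((1 + (1 + 1)) + (1 + 1)))))))))) := rfl
      rw [e]
      have hne : ∀ r < d, r ≠ d ∧ r ≠ d + 1 ∧ r ≠ d + 2 ∧ r ≠ d + 3 ∧ r ≠ d + 4 ∧ r ≠ d + 5 ∧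
          r ≠ d + 6 ∧ r ≠ d + 8 := by omega
      have hp : ∀ a : ℕ, a / 2 ^ i / 2 = a / 2 ^ (i + 1) := fun a => by
        rw [Nat.div_div_eq_div_mul, pow_succ]
      -- Halving, doubling and subtracting yields the lowest bit.
      have hm : ∀ a : ℕ, a - (a / 2 + a / 2) = a % 2 := fun a => by omega
      refine .seq (.half (.seq (.add (.seq (.sub (.seq (.copy (.seq (.half (.seq (.add (.seq
        (.sub (.seq (.copy (.seq (.add (.seq ?_))))))))))))))))))
      refine Ev.ite (fun hlt => .add (.seq (.add (.add ?_)))) (fun hlt => .skip (.seq (.add (.add ?_))))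
      · simp [h0, h1, h7, hm] at hlt
        refine ⟨?_, ?_, ?_, ?_, ?_, ?_, ?_, ?_⟩
        · simp [h0, hp]
        · simp [h1, hp]
        · simp [h2, h3, land_mod_step, hlt]
        · simp [h3, pow_succ, mul_two]
        · simp [h4, h7]
        · simp [h7]
        · intro r hrd
          simp [hne r hrd, hr r hrd]
        · simp [ha]
      · simp [h0, h1, h7, hm] at hlt
        refine ⟨?_, ?_, ?_, ?_, ?_, ?_, ?_, ?_⟩
        · simp [h0, hp]
        · simp [h1, hp]
        · simp [h2, land_mod_step, hlt]
        · simp [h3, pow_succ, mul_two]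
        · simp [h4, h7]
        · simp [h7]
        · intro r hrd
          simp [hne r hrd, hr r hrd]
        · simp [ha]
    · rintro τ ⟨-, -, h2, -, -, -, hr, ha⟩
      refine .copy ⟨by simp [h2], fun r hrd => ?_, by simp [ha]⟩
      simp [hrd.ne, hr r hrd]
  exact key.mono (by omega) fun _ h => h

/-- Evaluation behaves like a stack that starts at register `d`: everything below `d` survives, so
the first operand is safe while the second one is evaluated from `d + 1` on. -/
theorem Ex.compile_ev {B : List ℕ} {N : ℕ} {e : Ex} (he : e.ok B) :
    ∀ {d : ℕ} {σ τ : State}, 100 ≤ d → (∀ r ∈ B, σ.reg r ≤ N) → Sim σ τ →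
      Ev (e.compile d) τ (e.cost N) fun τ' =>
        τ'.reg d = e.den σ ∧ (∀ r < d, τ'.reg r = τ.reg r) ∧ τ'.arr = τ.arr := by
  induction e with
  | reg r =>
    intro d σ τ hd _ h
    simp only [Ex.ok, decide_eq_true_eq] at he
    refine .copy ⟨by simp [Ex.den, h.1 r he], fun x hx => ?_, rfl⟩
    simp [hx.ne]
  | const c =>
    intro d σ τ hd _ h
    refine .const ⟨by simp [Ex.den], fun x hx => ?_, rfl⟩
    simp [hx.ne]
  | add a b iha ihb =>
    intro d σ τ hd hB h
    simp only [Ex.ok, Bool.and_eq_true] at he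
    refine .seq ((iha he.1 hd hB h).mono le_rfl ?_)
    rintro τ₁ ⟨h1, hr1, ha1⟩
    refine .seq ((ihb he.2 (by omega) hB
      ⟨fun r hr => (hr1 r (by omega)).trans (h.1 r hr), ha1.trans h.2⟩).mono le_rfl ?_)
    rintro τ₂ ⟨h2, hr2, ha2⟩
    refine .add ⟨by simp [Ex.den, h2, hr2 d, h1], fun x hx => ?_, by simp [ha2, ha1]⟩
    simp [hx.ne, hr2 x (by omega), hr1 x hx]
  | sub a b iha ihb =>
    intro d σ τ hd hB h
    simp only [Ex.ok, Bool.and_eq_true] at he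
    refine .seq ((iha he.1 hd hB h).mono le_rfl ?_)
    rintro τ₁ ⟨h1, hr1, ha1⟩
    refine .seq ((ihb he.2 (by omega) hB
      ⟨fun r hr => (hr1 r (by omega)).trans (h.1 r hr), ha1.trans h.2⟩).mono le_rfl ?_)
    rintro τ₂ ⟨h2, hr2, ha2⟩
    refine .sub ⟨by simp [Ex.den, h2, hr2 d, h1], fun x hx => ?_, by simp [ha2, ha1]⟩
    simp [hx.ne, hr2 x (by omega), hr1 x hx]
  | load a e ih =>
    intro d σ τ hd hB h
    refine .seq ((ih he hd hB h).mono le_rfl ?_)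
    rintro τ₁ ⟨h1, hr1, ha1⟩
    refine .load ⟨by simp [Ex.den, h1, ha1, h.2], fun x hx => ?_, by simp [ha1]⟩
    simp [hx.ne, hr1 x hx]
  | land a b iha ihb =>
    intro d σ τ hd hB h
    simp only [Ex.ok, Bool.and_eq_true, List.contains_iff_mem] at he
    refine .seq ((iha he.2.1 hd hB h).mono le_rfl ?_)
    rintro τ₁ ⟨h1, hr1, ha1⟩
    refine .seq ((ihb he.2.2 (by omega) hB
      ⟨fun r hr => (hr1 r (by omega)).trans (h.1 r hr), ha1.trans h.2⟩).mono le_rfl ?_)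
    rintro τ₂ ⟨h2, hr2, ha2⟩
    have h5 : τ₂.reg 5 = σ.reg 5 := by
      rw [hr2 5 (by omega), hr1 5 (by omega), h.1 5 (by omega)]
    refine (landProg_ev d hd τ₂).mono ?_ ?_
    · have := hB 5 he.1
      rw [h5]; omega
    · rintro τ₃ ⟨h3, hr3, ha3⟩
      refine ⟨by rw [h3, h2, hr2 d (by omega), h1, h5, Ex.den], fun x hx => ?_, by
        rw [ha3, ha2, ha1]⟩
      rw [hr3 x hx, hr2 x (by omega), hr1 x hx]

/-- Commands; `rep x y c` runs `c` with `x = 0, …, y - 1`. -/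
inductive Cmd where
  | skip : Cmd
  | set (r : ℕ) (e : Ex) : Cmd
  | store (a : ℕ) (i e : Ex) : Cmd
  | seq (c d : Cmd) : Cmd
  | ite (e f : Ex) (c d : Cmd) : Cmd
  | rep (x y : ℕ) (c : Cmd) : Cmd

/-- `f 0`, …, `f (k - 1)` in this order. -/
def iter (f : ℕ → State → State) : ℕ → State → State
  | 0, σ => σ
  | k + 1, σ => f k (iter f k σ)

/-- The state after a command. -/
def Cmd.den : Cmd → State → State
  | .skip, σ => σ
  | .set r e, σ => σ.setReg r (e.den σ)
  | .store a i e, σ => σ.setArr a (i.den σ) (e.den σ)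
  | .seq c d, σ => d.den (c.den σ)
  | .ite e f c d, σ => if e.den σ < f.den σ then c.den σ else d.den σ
  | .rep x y c, σ => (iter (fun i τ => c.den (τ.setReg x i)) (σ.reg y) σ).setReg x (σ.reg y)

/-- The registers that a command may change. -/
def Cmd.writes : Cmd → List ℕ
  | .skip => []
  | .set r _ => [r]
  | .store _ _ _ => []
  | .seq c d => c.writes ++ d.writes
  | .ite _ _ c d => c.writes ++ d.writes
  | .rep x _ c => x :: c.writes

/-- The arrays that a command may change. -/
def Cmd.writesArr : Cmd → List ℕ
  | .skip => []
  | .set _ _ => []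
  | .store a _ _ => [a]
  | .seq c d => c.writesArr ++ d.writesArr
  | .ite _ _ c d => c.writesArr ++ d.writesArr
  | .rep _ _ c => c.writesArr

/-- The command uses only registers below `100`, its loops are bounded by registers in `B`, and
it changes neither these registers nor the counter of a loop inside the loop. -/
def Cmd.ok (B : List ℕ) : Cmd → Bool
  | .skip => true
  | .set r e => decide (r < 100) && !B.contains r && e.ok B
  | .store _ i e => i.ok B && e.ok B
  | .seq c d => c.ok B && d.ok B
  | .ite e f c d => e.ok B && f.ok B && (c.ok B && d.ok B)
  | .rep x y c => decide (x < 100) && !B.contains x && (decide (y < 100) && B.contains y) &&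
      (!c.writes.contains x && c.ok B)

/-- The program for a command. -/
def Cmd.compile : Cmd → Prog
  | .skip => .skip
  | .set r e => .seq (e.compile 100) (.copy r 100)
  | .store a i e => .seq (i.compile 100) (.seq (e.compile 101) (.store a 100 101))
  | .seq c d => .seq c.compile d.compile
  | .ite e f c d => .seq (e.compile 100) (.seq (f.compile 101) (.ite 100 101 c.compile d.compile))
  | .rep x y c => .seq (.const x 0) (.loop x y (.seq c.compile (.seq (.const 100 1) (.add x x 100))))

/-- A bound on the number of steps, if the registers that bound loops contain at most `N`. -/
def Cmd.cost (N : ℕ) : Cmd → ℕ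
  | .skip => 1
  | .set _ e => e.cost N + 1
  | .store _ i e => i.cost N + (e.cost N + 1)
  | .seq c d => c.cost N + d.cost N
  | .ite e f c d => e.cost N + (f.cost N + (1 + (c.cost N + d.cost N)))
  | .rep _ _ c => 1 + (N * (c.cost N + (1 + 1) + 1) + 1)

/-- The two states differ only in what the command may change. -/
def Cmd.Frame (c : Cmd) (σ τ : State) : Prop :=
  (∀ r ∉ c.writes, τ.reg r = σ.reg r) ∧ ∀ a ∉ c.writesArr, τ.arr a = σ.arr a

/-- Since `writes` and `writesArr` are computable lists, `decide` settles later which registers and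
arrays a loop preserves. -/
theorem Cmd.frame (c : Cmd) : ∀ σ, c.Frame σ (c.den σ) := by
  induction c with
  | skip => exact fun σ => ⟨fun _ _ => rfl, fun _ _ => rfl⟩
  | set r e =>
    refine fun σ => ⟨fun x hx => ?_, fun _ _ => rfl⟩
    simp only [Cmd.writes, List.mem_singleton] at hx
    simp [Cmd.den, hx]
  | store a i e =>
    refine fun σ => ⟨fun _ _ => rfl, fun b hb => ?_⟩
    simp only [Cmd.writesArr, List.mem_singleton] at hb
    ext; simp [Cmd.den, hb]
  | seq c d ihc ihd =>
    intro σ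
    constructor
    · intro r hr
      simp only [Cmd.writes, List.mem_append, not_or] at hr
      rw [Cmd.den, (ihd _).1 r hr.2, (ihc _).1 r hr.1]
    · intro r hr
      simp only [Cmd.writesArr, List.mem_append, not_or] at hr
      rw [Cmd.den, (ihd _).2 r hr.2, (ihc _).2 r hr.1]
  | ite e f c d ihc ihd =>
    intro σ
    constructor
    · intro r hr
      simp only [Cmd.writes, List.mem_append, not_or] at hr
      rw [Cmd.den]
      split_ifs
      exacts [(ihc _).1 r hr.1, (ihd _).1 r hr.2]
    · intro r hr
      simp only [Cmd.writesArr, List.mem_append, not_or] at hr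
      rw [Cmd.den]
      split_ifs
      exacts [(ihc _).2 r hr.1, (ihd _).2 r hr.2]
  | rep x y c ih =>
    intro σ
    have H : ∀ k, (∀ r ∉ (Cmd.rep x y c).writes,
        (iter (fun i τ => c.den (τ.setReg x i)) k σ).reg r = σ.reg r) ∧
        ∀ a ∉ c.writesArr, (iter (fun i τ => c.den (τ.setReg x i)) k σ).arr a = σ.arr a := by
      intro k
      induction k with
      | zero => exact ⟨fun _ _ => rfl, fun _ _ => rfl⟩
      | succ k ihk =>
        constructor
        · intro r hr
          have hr' := hr
          simp only [Cmd.writes, List.mem_cons, not_or] at hr'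
          rw [iter, (ih _).1 r hr'.2, State.setReg_reg, if_neg hr'.1, ihk.1 r hr]
        · intro a ha
          rw [iter, (ih _).2 a ha, State.setReg_arr, ihk.2 a ha]
    constructor
    · intro r hr
      have hr' := hr
      simp only [Cmd.writes, List.mem_cons, not_or] at hr'
      rw [Cmd.den, State.setReg_reg, if_neg hr'.1, (H _).1 r hr]
    · intro a ha
      rw [Cmd.den, State.setReg_arr, (H _).2 a ha]

end RAM

/-! ### Correctness and cost of compiled commands -/

namespace RAM

theorem Cmd.den_skip (σ : State) : Cmd.skip.den σ = σ := rfl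

theorem Cmd.den_set (σ : State) (r : ℕ) (e : Ex) : (Cmd.set r e).den σ = σ.setReg r (e.den σ) := rfl

theorem Cmd.den_store (σ : State) (a : ℕ) (i e : Ex) :
    (Cmd.store a i e).den σ = σ.setArr a (i.den σ) (e.den σ) := rfl

theorem Cmd.den_seq (σ : State) (c d : Cmd) : (Cmd.seq c d).den σ = d.den (c.den σ) := rfl

theorem Cmd.den_ite (σ : State) (e f : Ex) (c d : Cmd) :
    (Cmd.ite e f c d).den σ = if e.den σ < f.den σ then c.den σ else d.den σ := rfl

/-- The language only tests `<`; adding one on the right gives `≤`, the form of the subset and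
threshold tests. -/
theorem Cmd.den_ite_le (σ : State) (e f : Ex) (c d : Cmd) :
    (Cmd.ite e (.add f (.const 1)) c d).den σ =
      if e.den σ ≤ f.den σ then c.den σ else d.den σ := by
  have h : e.den σ < (Ex.add f (.const 1)).den σ ↔ e.den σ ≤ f.den σ := Nat.lt_succ_iff
  simp only [Cmd.den_ite, h]

theorem Cmd.not_mem_writes {B : List ℕ} {c : Cmd} (hc : c.ok B) : ∀ r ∈ B, r ∉ c.writes := by
  induction c with
  | skip => simp [Cmd.writes]
  | set r e =>
    simp only [Cmd.ok, Bool.and_eq_true, Bool.not_eq_true', List.contains_eq_mem,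
      decide_eq_false_iff_not] at hc
    intro x hx hxr
    simp only [Cmd.writes, List.mem_singleton] at hxr
    exact hc.1.2 (hxr ▸ hx)
  | store a i e => simp [Cmd.writes]
  | seq c d ihc ihd =>
    simp only [Cmd.ok, Bool.and_eq_true] at hc
    intro r hr
    simp only [Cmd.writes, List.mem_append, not_or]
    exact ⟨ihc hc.1 r hr, ihd hc.2 r hr⟩
  | ite e f c d ihc ihd =>
    simp only [Cmd.ok, Bool.and_eq_true] at hc
    intro r hr
    simp only [Cmd.writes, List.mem_append, not_or]
    exact ⟨ihc hc.2.1 r hr, ihd hc.2.2 r hr⟩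
  | rep x y c ih =>
    simp only [Cmd.ok, Bool.and_eq_true, Bool.not_eq_true', List.contains_eq_mem,
      decide_eq_false_iff_not] at hc
    intro r hr
    simp only [Cmd.writes, List.mem_cons, not_or]
    exact ⟨fun h => hc.1.1.2 (h ▸ hr), ih hc.2.2 r hr⟩

theorem Sim.setReg {σ τ : State} (h : Sim σ τ) (r m : ℕ) : Sim (σ.setReg r m) (τ.setReg r m) := by
  refine ⟨fun x hx => ?_, h.2⟩
  simp [h.1 x hx]

theorem Sim.of_agree {σ τ τ' : State} (h : Sim σ τ) (hr : ∀ r < 100, τ'.reg r = τ.reg r)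
    (ha : τ'.arr = τ.arr) : Sim σ τ' :=
  ⟨fun r h100 => (hr r h100).trans (h.1 r h100), ha.trans h.2⟩

/-- Registers in `B` are never written, so the bound `N` on them holds during the whole run. Each
`rep` is then a loop with at most `N` rounds, and the static `cost` applies. -/
theorem Cmd.compile_ev {B : List ℕ} {N : ℕ} {c : Cmd} (hc : c.ok B) :
    ∀ {σ τ : State}, (∀ r ∈ B, σ.reg r ≤ N) → Sim σ τ →
      Ev c.compile τ (c.cost N) (Sim (c.den σ)) := by
  induction c with
  | skip => exact fun _ h => .skip h
  | set r e =>
    intro σ τ hB h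
    simp only [Cmd.ok, Bool.and_eq_true] at hc
    refine .seq ((Ex.compile_ev hc.2 le_rfl hB h).mono le_rfl ?_)
    rintro τ₁ ⟨h1, hr1, ha1⟩
    refine .copy ?_
    rw [h1]
    exact (h.of_agree hr1 ha1).setReg _ _
  | store a i e =>
    intro σ τ hB h
    simp only [Cmd.ok, Bool.and_eq_true] at hc
    refine .seq ((Ex.compile_ev hc.1 le_rfl hB h).mono le_rfl ?_)
    rintro τ₁ ⟨h1, hr1, ha1⟩
    have hs := h.of_agree hr1 ha1
    refine .seq ((Ex.compile_ev hc.2 (by omega : 100 ≤ 101) hB hs).mono le_rfl ?_)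
    rintro τ₂ ⟨h2, hr2, ha2⟩
    refine .store ?_
    rw [h2, hr2 100 (by omega), h1]
    have hs2 := hs.of_agree (fun r hr => hr2 r (by omega)) ha2
    refine ⟨hs2.1, ?_⟩
    simp [Cmd.den, State.setArr, hs2.2]
  | seq c d ihc ihd =>
    intro σ τ hB h
    simp only [Cmd.ok, Bool.and_eq_true] at hc
    refine .seq ((ihc hc.1 hB h).mono le_rfl fun τ₁ h₁ => ?_)
    refine ihd hc.2 (fun r hr => ?_) h₁
    rw [(c.frame σ).1 r (not_mem_writes hc.1 r hr)]
    exact hB r hr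
  | ite e f c d ihc ihd =>
    intro σ τ hB h
    simp only [Cmd.ok, Bool.and_eq_true] at hc
    refine .seq ((Ex.compile_ev hc.1.1 le_rfl hB h).mono le_rfl ?_)
    rintro τ₁ ⟨h1, hr1, ha1⟩
    have hs := h.of_agree hr1 ha1
    refine .seq ((Ex.compile_ev hc.1.2 (by omega : 100 ≤ 101) hB hs).mono le_rfl ?_)
    rintro τ₂ ⟨h2, hr2, ha2⟩
    have hs2 := hs.of_agree (fun r hr => hr2 r (by omega)) ha2
    have e1 : τ₂.reg 100 = e.den σ := by rw [hr2 100 (by omega), h1]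
    refine .ite (fun hlt => ?_) fun hlt => ?_
    · rw [e1, h2] at hlt
      simpa only [Cmd.den, if_pos hlt] using ihc hc.2.1 hB hs2
    · rw [e1, h2] at hlt
      simpa only [Cmd.den, if_neg hlt] using ihd hc.2.2 hB hs2
  | rep x y c ih =>
    intro σ τ hB h
    have hy : y ∉ (Cmd.rep x y c).writes := by
      refine not_mem_writes hc y ?_
      simp only [Cmd.ok, Bool.and_eq_true, List.contains_iff_mem] at hc
      exact hc.1.2.2
    have hBw := not_mem_writes hc
    simp only [Cmd.ok, Bool.and_eq_true, Bool.not_eq_true', List.contains_eq_mem,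
      decide_eq_false_iff_not, decide_eq_true_eq] at hc
    obtain ⟨⟨⟨hx100, hxB⟩, hy100, hyB⟩, hxw, hcok⟩ := hc
    simp only [Cmd.writes, List.mem_cons, not_or] at hy
    have hfr : ∀ k, ∀ r ∈ B, (iter (fun i τ => c.den (τ.setReg x i)) k σ).reg r = σ.reg r := by
      intro k r hr
      induction k with
      | zero => rfl
      | succ k ihk =>
        have hrw := hBw r hr
        simp only [Cmd.writes, List.mem_cons, not_or] at hrw
        rw [iter, (c.frame _).1 r hrw.2, State.setReg_reg, if_neg hrw.1, ihk]
    refine .seq (.const ?_)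
    -- At the head of the loop the counter already holds `k`, whereas `iter` sets it only on
    -- entering the body; hence the extra `setReg x k` in the invariant.
    refine ((Ev.loop (N := σ.reg y) (s := c.cost N + (1 + 1)) (fun k τ =>
      Sim ((iter (fun i τ => c.den (τ.setReg x i)) k σ).setReg x k) τ)
      (h.setReg x 0) ?_ ?_).mono ?_ fun _ h => h)
    · intro k τ' hs
      rw [hs.1 x hx100, hs.1 y hy100]
      simp [hy.1, hfr k y hyB]
    · intro k τ' hk hs
      refine .seq ((ih hcok (fun r hr => ?_) hs).mono le_rfl ?_)
      · rw [State.setReg_reg, if_neg (by rintro rfl; exact hxB hr), hfr k r hr]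
        exact hB r hr
      · intro τ₁ h₁
        refine .seq (.const (.add ?_))
        have hxk : τ₁.reg x = k := by
          rw [h₁.1 x hx100, (c.frame _).1 x hxw]
          simp
        refine ⟨fun r hr => ?_, h₁.2⟩
        have h1 := h₁.1 r hr
        simp only [State.setReg_reg, iter]
        split_ifs <;> omega
    · have := Nat.mul_le_mul_right (c.cost N + (1 + 1) + 1) (hB y hyB)
      omega

theorem Ex.exists_cost_le (e : Ex) : ∃ K, ∀ N, e.cost N ≤ K * (N + 1) := by
  induction e with
  | reg r => exact ⟨1, fun N => by simp [Ex.cost]⟩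
  | const c => exact ⟨1, fun N => by simp [Ex.cost]⟩
  | add a b iha ihb =>
    obtain ⟨K, hK⟩ := iha
    obtain ⟨L, hL⟩ := ihb
    exact ⟨K + L + 1, fun N => by have := hK N; have := hL N; simp only [Ex.cost]; nlinarith⟩
  | sub a b iha ihb =>
    obtain ⟨K, hK⟩ := iha
    obtain ⟨L, hL⟩ := ihb
    exact ⟨K + L + 1, fun N => by have := hK N; have := hL N; simp only [Ex.cost]; nlinarith⟩
  | load a e ih =>
    obtain ⟨K, hK⟩ := ih
    exact ⟨K + 1, fun N => by have := hK N; simp only [Ex.cost]; nlinarith⟩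
  | land a b iha ihb =>
    obtain ⟨K, hK⟩ := iha
    obtain ⟨L, hL⟩ := ihb
    exact ⟨K + L + 15, fun N => by have := hK N; have := hL N; simp only [Ex.cost]; nlinarith⟩

/-- The number of steps is polynomial in the bounds on the loops. -/
theorem Cmd.exists_cost_le (c : Cmd) : ∃ K D, ∀ N, c.cost N ≤ K * (N + 1) ^ D := by
  have mono : ∀ {K D N x : ℕ} (D' : ℕ), x ≤ K * (N + 1) ^ D → x ≤ K * (N + 1) ^ (D + D') :=
    fun D' h => h.trans (Nat.mul_le_mul_left _ (Nat.pow_le_pow_right (by omega) (by omega)))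
  have one : ∀ N D : ℕ, 1 ≤ (N + 1) ^ D := fun N D => Nat.one_le_pow _ _ (by omega)
  induction c with
  | skip => exact ⟨1, 0, fun N => by simp [Cmd.cost]⟩
  | set r e =>
    obtain ⟨K, hK⟩ := e.exists_cost_le
    exact ⟨K + 1, 1, fun N => by have := hK N; simp only [Cmd.cost, pow_one]; nlinarith⟩
  | store a i e =>
    obtain ⟨K, hK⟩ := i.exists_cost_le
    obtain ⟨L, hL⟩ := e.exists_cost_le
    exact ⟨K + L + 1, 1, fun N => by
      have := hK N; have := hL N; simp only [Cmd.cost, pow_one]; nlinarith⟩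
  | seq c d ihc ihd =>
    obtain ⟨K, D, hK⟩ := ihc
    obtain ⟨L, E, hL⟩ := ihd
    refine ⟨K + L, D + E, fun N => ?_⟩
    have h1 := mono E (hK N)
    have h2 := mono D (hL N)
    rw [add_comm E D] at h2
    simp only [Cmd.cost]; nlinarith
  | ite e f c d ihc ihd =>
    obtain ⟨A, hA⟩ := e.exists_cost_le
    obtain ⟨A', hA'⟩ := f.exists_cost_le
    obtain ⟨K, D, hK⟩ := ihc
    obtain ⟨L, E, hL⟩ := ihd
    refine ⟨A + A' + K + L + 1, 1 + D + E, fun N => ?_⟩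
    have h1 := mono (1 + E) (hK N)
    have h2 := mono (1 + D) (hL N)
    have h3 := mono (D := 1) (D + E) (by simpa using hA N)
    have h4 := mono (D := 1) (D + E) (by simpa using hA' N)
    rw [show D + (1 + E) = 1 + D + E by ring] at h1
    rw [show E + (1 + D) = 1 + D + E by ring] at h2
    rw [show 1 + (D + E) = 1 + D + E by ring] at h3 h4
    have := one N (1 + D + E)
    simp only [Cmd.cost]; nlinarith
  | rep x y c ih =>
    obtain ⟨K, D, hK⟩ := ih
    refine ⟨K + 5, D + 1, fun N => ?_⟩
    have h1 := hK N
    have h2 := one N D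
    have h3 : N * c.cost N ≤ N * (K * (N + 1) ^ D) := Nat.mul_le_mul_left _ h1
    have h4 : N ≤ N * (N + 1) ^ D := Nat.le_mul_of_pos_right _ h2
    simp only [Cmd.cost, pow_succ]
    nlinarith [Nat.zero_le (K * (N + 1) ^ D)]

/-- The invariant rule for counted loops. -/
theorem Cmd.rep_inv {x y : ℕ} {c : Cmd} {σ : State} {Q : State → Prop} (Inv : ℕ → State → Prop)
    (h₀ : Inv 0 σ)
    (hstep : ∀ i τ, i < σ.reg y → (Cmd.rep x y c).Frame σ τ → Inv i τ →
      Inv (i + 1) (c.den (τ.setReg x i)))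
    (hQ : ∀ τ, (Cmd.rep x y c).Frame σ τ → Inv (σ.reg y) τ → Q (τ.setReg x (σ.reg y))) :
    Q ((Cmd.rep x y c).den σ) := by
  have hfr : ∀ k, (Cmd.rep x y c).Frame σ (iter (fun i τ => c.den (τ.setReg x i)) k σ) := by
    intro k
    induction k with
    | zero => exact ⟨fun _ _ => rfl, fun _ _ => rfl⟩
    | succ k ihk =>
      refine ⟨fun r hr => ?_, fun a ha => ?_⟩
      · have hr' := hr
        simp only [Cmd.writes, List.mem_cons, not_or] at hr'
        rw [iter, (c.frame _).1 r hr'.2, State.setReg_reg, if_neg hr'.1, ihk.1 r hr]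
      · rw [iter, (c.frame _).2 a ha, State.setReg_arr, ihk.2 a ha]
  suffices H : ∀ k ≤ σ.reg y, Inv k (iter (fun i τ => c.den (τ.setReg x i)) k σ) from
    hQ _ (hfr _) (H _ le_rfl)
  intro k hk
  induction k with
  | zero => exact h₀
  | succ k ih => exact hstep k _ (by omega) (hfr k) (ih (by omega))

end RAM

/-! ## The algorithm -/

namespace WVI

open RAM

/-! ### Packing disjoint subsets by dynamic programming -/

/-- The conjunction of the lowest `m` bits. -/
def band (m a b : ℕ) : ℕ := (a &&& b) % 2 ^ m

/-- `Pack m g l Y s`: the set `Y` contains disjoint nonempty sets of values at most `l`, with sum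
of values `s`. Sets are given by bit masks, and `g` gives the values. -/
inductive Pack (m : ℕ) (g : ℕ → ℕ) (l : ℕ) : ℕ → ℕ → Prop
  | nil (Y : ℕ) : Pack m g l Y 0
  | cons {Y Q s : ℕ} : 0 < Q → Q ≤ band m Q Y → g Q ≤ l → Pack m g l (Y - Q) s →
      Pack m g l Y (g Q + s)

/-- Tabulates in array `5` the largest values of packings. The values of the sets are in array `4`,
and the threshold is the value of the set in register `13`. -/
def packTable : Cmd :=
  .rep 17 3 (.seq (.store 5 (.reg 17) (.const 0))
    (.rep 18 3 (.ite (.reg 18) (.add (.land (.reg 18) (.reg 17)) (.const 1))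
      (.ite (.load 4 (.reg 18)) (.add (.load 4 (.reg 13)) (.const 1))
        (.store 5 (.reg 17) (.add (.load 5 (.reg 17))
          (.sub (.add (.load 4 (.reg 18)) (.load 5 (.sub (.reg 17) (.reg 18))))
            (.load 5 (.reg 17)))))
        .skip) .skip)))

theorem band_le_left (m a b : ℕ) : band m a b ≤ a := (Nat.mod_le _ _).trans Nat.and_le_left

theorem band_le_right (m a b : ℕ) : band m a b ≤ b := (Nat.mod_le _ _).trans Nat.and_le_right

theorem band_lt (m a b : ℕ) : band m a b < 2 ^ m := Nat.mod_lt _ (by positivity)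

/-- A nonempty packing of `Y` consists of a first set `Q` and a packing of `Y - Q`. Since `0 < Q`,
the number `Y - Q` is smaller than `Y` and its entry is already final when the masks are treated in
increasing order. -/
theorem packTable_den (σ : State) (h3 : σ.reg 3 = 2 ^ σ.reg 5) (h4 : σ.arr 4 0 = 0) :
    ∀ Y < 2 ^ σ.reg 5, IsGreatest {s | Pack (σ.reg 5) (σ.arr 4) (σ.arr 4 (σ.reg 13)) Y s}
      ((packTable.den σ).arr 5 Y) := by
  refine Cmd.rep_inv (Q := fun τ => ∀ Y < 2 ^ σ.reg 5,
    IsGreatest {s | Pack (σ.reg 5) (σ.arr 4) (σ.arr 4 (σ.reg 13)) Y s} (τ.arr 5 Y))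
    (fun i τ => ∀ Y < i,
      IsGreatest {s | Pack (σ.reg 5) (σ.arr 4) (σ.arr 4 (σ.reg 13)) Y s} (τ.arr 5 Y)) ?_ ?_ ?_
  · intro Y hY; omega
  · intro i τ hi hF hI
    have f3 := hF.1 3 (by decide)
    have f5 := hF.1 5 (by decide)
    have f13 := hF.1 13 (by decide)
    have a4 := hF.2 4 (by decide)
    simp only [Cmd.den_seq, Cmd.den_store]
    set τ₀ := ((τ.setReg 17 i).setArr 5 ((Ex.reg 17).den (τ.setReg 17 i))
      ((Ex.const 0).den (τ.setReg 17 i))) with hτ₀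
    have t17 : τ₀.reg 17 = i := by simp [hτ₀]
    have t3 : τ₀.reg 3 = σ.reg 3 := by simp [hτ₀, f3]
    have t5 : τ₀.reg 5 = σ.reg 5 := by simp [hτ₀, f5]
    have t13 : τ₀.reg 13 = σ.reg 13 := by simp [hτ₀, f13]
    have ta4 : τ₀.arr 4 = σ.arr 4 := by ext; simp [hτ₀, a4]
    have ti : τ₀.arr 5 i = 0 := by simp [hτ₀, Ex.den]
    have tI : ∀ Y < i, IsGreatest {s | Pack (σ.reg 5) (σ.arr 4) (σ.arr 4 (σ.reg 13)) Y s}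
        (τ₀.arr 5 Y) := by
      intro Y hY
      have := hI Y hY
      simpa [hτ₀, Ex.den, hY.ne] using this
    clear_value τ₀
    -- Inner invariant: the entry of `i` is attained by a packing and dominates every packing whose
    -- first set has a mask below `q`.
    refine Cmd.rep_inv (Q := fun τ => ∀ Y < i + 1,
      IsGreatest {s | Pack (σ.reg 5) (σ.arr 4) (σ.arr 4 (σ.reg 13)) Y s} (τ.arr 5 Y))
      (fun q τ => (∀ Y < i,
        IsGreatest {s | Pack (σ.reg 5) (σ.arr 4) (σ.arr 4 (σ.reg 13)) Y s} (τ.arr 5 Y)) ∧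
        Pack (σ.reg 5) (σ.arr 4) (σ.arr 4 (σ.reg 13)) i (τ.arr 5 i) ∧
        ∀ Q < q, 0 < Q → Q ≤ band (σ.reg 5) Q i → σ.arr 4 Q ≤ σ.arr 4 (σ.reg 13) →
          ∀ s, Pack (σ.reg 5) (σ.arr 4) (σ.arr 4 (σ.reg 13)) (i - Q) s →
            σ.arr 4 Q + s ≤ τ.arr 5 i) ?_ ?_ ?_
    · exact ⟨tI, by rw [ti]; exact .nil _, fun Q hQ => by omega⟩
    · rintro q ρ hq hG ⟨hI1, hI2, hI3⟩
      have g17 : ρ.reg 17 = i := (hG.1 17 (by decide)).trans t17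
      have g5 : ρ.reg 5 = σ.reg 5 := (hG.1 5 (by decide)).trans t5
      have g13 : ρ.reg 13 = σ.reg 13 := (hG.1 13 (by decide)).trans t13
      have ga4 : ρ.arr 4 = σ.arr 4 := (hG.2 4 (by decide)).trans ta4
      have e1 : (Ex.reg 18).den (ρ.setReg 18 q) ≤
          (Ex.land (.reg 18) (.reg 17)).den (ρ.setReg 18 q) ↔ q ≤ band (σ.reg 5) q i := by
        simp [Ex.den, g17, g5, band]
      have e2 : (Ex.load 4 (.reg 18)).den (ρ.setReg 18 q) ≤
          (Ex.load 4 (.reg 13)).den (ρ.setReg 18 q) ↔ σ.arr 4 q ≤ σ.arr 4 (σ.reg 13) := by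
        simp [Ex.den, g13, ga4]
      have e3 : (Cmd.store 5 (.reg 17) (.add (.load 5 (.reg 17))
          (.sub (.add (.load 4 (.reg 18)) (.load 5 (.sub (.reg 17) (.reg 18))))
            (.load 5 (.reg 17))))).den (ρ.setReg 18 q) = (ρ.setReg 18 q).setArr 5 i
              (ρ.arr 5 i + (σ.arr 4 q + ρ.arr 5 (i - q) - ρ.arr 5 i)) := by
        simp [Cmd.den_store, Ex.den, g17, ga4]
      rw [Cmd.den_ite_le, Cmd.den_ite_le, e3]
      simp only [e1, e2, Cmd.den_skip]
      split_ifs with hc1 hc2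
      · have hqi : q ≤ i := hc1.trans (band_le_right _ _ _)
        have hval : Pack (σ.reg 5) (σ.arr 4) (σ.arr 4 (σ.reg 13)) i
              (σ.arr 4 q + ρ.arr 5 (i - q)) ∧
            (0 < q → ∀ s, Pack (σ.reg 5) (σ.arr 4) (σ.arr 4 (σ.reg 13)) (i - q) s →
              s ≤ ρ.arr 5 (i - q)) := by
          -- The program does not exclude `q = 0`. That round is harmless: the value of the empty
          -- set is `0`, so the entry is compared with itself.
          rcases Nat.eq_zero_or_pos q with rfl | hq0
          · simpa [h4] using hI2
          · have := hI1 (i - q) (by omega)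
            exact ⟨.cons hq0 hc1 hc2 this.1, fun _ s hs => this.2 hs⟩
        -- With truncated subtraction, `a + (b - a)` is the maximum of `a` and `b`.
        have hmax : ρ.arr 5 i + (σ.arr 4 q + ρ.arr 5 (i - q) - ρ.arr 5 i) =
            max (ρ.arr 5 i) (σ.arr 4 q + ρ.arr 5 (i - q)) := by omega
        refine ⟨fun Y hY => ?_, ?_, ?_⟩
        · simpa [hY.ne] using hI1 Y hY
        · simp only [State.setArr_arr, and_self, if_true, State.setReg_arr, hmax]
          rcases max_choice (ρ.arr 5 i) (σ.arr 4 q + ρ.arr 5 (i - q)) with h | h <;> rw [h]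
          exacts [hI2, hval.1]
        · intro Q hQ hQ0 hQb hQl s hs
          simp only [State.setArr_arr, and_self, if_true, hmax]
          rcases Nat.lt_or_ge Q q with hlt | hge
          · exact le_max_of_le_left (hI3 Q hlt hQ0 hQb hQl s hs)
          · obtain rfl : Q = q := by omega
            exact le_max_of_le_right (Nat.add_le_add_left (hval.2 hQ0 s hs) _)
      · refine ⟨hI1, hI2, fun Q hQ hQ0 hQb hQl s hs => ?_⟩
        rcases Nat.lt_or_ge Q q with hlt | hge
        · exact hI3 Q hlt hQ0 hQb hQl s hs
        · obtain rfl : Q = q := by omega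
          exact absurd hQl hc2
      · refine ⟨hI1, hI2, fun Q hQ hQ0 hQb hQl s hs => ?_⟩
        rcases Nat.lt_or_ge Q q with hlt | hge
        · exact hI3 Q hlt hQ0 hQb hQl s hs
        · obtain rfl : Q = q := by omega
          exact absurd hQb hc1
    · rintro ρ hG ⟨hI1, hI2, hI3⟩ Y hY
      rcases Nat.lt_or_ge Y i with hlt | hge
      · exact hI1 Y hlt
      · obtain rfl : Y = i := by omega
        refine ⟨hI2, ?_⟩
        rintro s (_ | ⟨hQ0, hQb, hQl, hs⟩)
        · exact Nat.zero_le _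
        -- A subset of a mask has only bits below `m`, so the inner loop has met it.
        · refine hI3 _ ?_ hQ0 hQb hQl _ hs
          rw [t3, h3]
          exact hQb.trans_lt (band_lt _ _ _)
  · intro τ _ hI Y hY
    exact hI Y (by rw [h3]; exact hY)

/-! ### Weights gained by the parts of the kept cover vertices -/

/-- The vertex `v` is not one of the deleted vertices of the cover, if `Z` is the set of
vertices of the cover that are not deleted. -/
def Kept (m : ℕ) (pw : ℕ → ℕ) (Z v : ℕ) : Prop := pw v ≤ band m (pw v) Z

instance (m : ℕ) (pw : ℕ → ℕ) (Z v : ℕ) : Decidable (Kept m pw Z v) :=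
  inferInstanceAs (Decidable (_ ≤ _))

/-- The weight of the vertices that have their neighbours in `Z`, at least one, in `X`. -/
def gain (n m : ℕ) (w pw nb : ℕ → ℕ) (Z X : ℕ) : ℕ :=
  ∑ v ∈ Finset.range n, if Kept m pw Z v ∧ 0 < band m (nb v) Z ∧
    band m (nb v) Z ≤ band m (band m (nb v) Z) X then w v else 0

/-- The weight of the vertices without neighbours in `Z`. -/
def isoWeight (n m : ℕ) (w pw nb : ℕ → ℕ) (Z : ℕ) : ℕ :=
  ∑ v ∈ Finset.range n, if Kept m pw Z v ∧ ¬ 0 < band m (nb v) Z then w v else 0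

/-- The largest weight of a vertex without neighbours in `Z`. -/
def isoMax (n m : ℕ) (w pw nb : ℕ → ℕ) (Z : ℕ) : ℕ :=
  (Finset.range n).sup fun v => if Kept m pw Z v ∧ ¬ 0 < band m (nb v) Z then w v else 0

/-- Adds the weight of the vertex in register `10` to the table of `gain`, or to `isoWeight` and
`isoMax`. -/
def gainStep : Cmd :=
  .ite (.load 2 (.reg 10)) (.add (.land (.load 2 (.reg 10)) (.reg 12)) (.const 1))
    (.seq (.set 16 (.land (.load 3 (.reg 10)) (.reg 12)))
      (.ite (.const 0) (.reg 16)
        (.rep 13 3 (.ite (.reg 16) (.add (.land (.reg 16) (.reg 13)) (.const 1))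
          (.store 4 (.reg 13) (.add (.load 4 (.reg 13)) (.load 0 (.reg 10)))) .skip))
        (.seq (.set 14 (.add (.reg 14) (.load 0 (.reg 10))))
          (.set 15 (.add (.reg 15) (.sub (.load 0 (.reg 10)) (.reg 15)))))))
    .skip

/-- Tabulates in array `4` the function `gain` for the set `Z` in register `12`, and computes
`isoWeight` and `isoMax`. -/
def gainTable : Cmd :=
  .seq (.rep 13 3 (.store 4 (.reg 13) (.const 0))) <|
  .seq (.set 14 (.const 0)) <| .seq (.set 15 (.const 0)) (.rep 10 0 gainStep)

/-- This is the contribution of a single vertex, so that `gainTable_den` only has to sum, or take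
the maximum, over the vertices. -/
theorem gainStep_den (σ : State) (h3 : σ.reg 3 = 2 ^ σ.reg 5) :
    (∀ X < 2 ^ σ.reg 5, (gainStep.den σ).arr 4 X = σ.arr 4 X +
      if Kept (σ.reg 5) (σ.arr 2) (σ.reg 12) (σ.reg 10) ∧
        0 < band (σ.reg 5) (σ.arr 3 (σ.reg 10)) (σ.reg 12) ∧
        band (σ.reg 5) (σ.arr 3 (σ.reg 10)) (σ.reg 12) ≤
          band (σ.reg 5) (band (σ.reg 5) (σ.arr 3 (σ.reg 10)) (σ.reg 12)) X
      then σ.arr 0 (σ.reg 10) else 0) ∧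
    (gainStep.den σ).reg 14 = σ.reg 14 + (if Kept (σ.reg 5) (σ.arr 2) (σ.reg 12) (σ.reg 10) ∧
      ¬ 0 < band (σ.reg 5) (σ.arr 3 (σ.reg 10)) (σ.reg 12) then σ.arr 0 (σ.reg 10) else 0) ∧
    (gainStep.den σ).reg 15 = max (if Kept (σ.reg 5) (σ.arr 2) (σ.reg 12) (σ.reg 10) ∧
      ¬ 0 < band (σ.reg 5) (σ.arr 3 (σ.reg 10)) (σ.reg 12) then σ.arr 0 (σ.reg 10) else 0)
      (σ.reg 15) := by
  by_cases hK : Kept (σ.reg 5) (σ.arr 2) (σ.reg 12) (σ.reg 10)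
  swap
  · have hK' : ¬ ((Ex.load 2 (.reg 10)).den σ <
        (Ex.add (.land (.load 2 (.reg 10)) (.reg 12)) (.const 1)).den σ) := by
      simpa [Ex.den, Nat.lt_succ_iff, Kept, band] using hK
    simp only [gainStep, Cmd.den_ite, Cmd.den_skip, if_neg hK', hK, false_and, if_false, add_zero]
    simp
  have hK' : ((Ex.load 2 (.reg 10)).den σ <
      (Ex.add (.land (.load 2 (.reg 10)) (.reg 12)) (.const 1)).den σ) := by
    simpa [Ex.den, Nat.lt_succ_iff, Kept, band] using hK
  simp only [gainStep, Cmd.den_ite, Cmd.den_seq, Cmd.den_set, if_pos hK', hK, true_and]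
  set M := band (σ.reg 5) (σ.arr 3 (σ.reg 10)) (σ.reg 12) with hM
  set τ := σ.setReg 16 ((Ex.land (.load 3 (.reg 10)) (.reg 12)).den σ) with hτ
  have t16 : τ.reg 16 = M := by simp [hτ, hM, Ex.den, band]
  have tr : ∀ r < 16, τ.reg r = σ.reg r := fun r hr => by simp [hτ, hr.ne]
  have ta : τ.arr = σ.arr := rfl
  clear_value τ M
  by_cases h0 : 0 < M
  · have h0' : (Ex.const 0).den τ < (Ex.reg 16).den τ := by simpa [Ex.den, t16] using h0
    simp only [if_pos h0', h0, true_and, not_true, if_false, Nat.zero_max, add_zero]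
    refine ⟨?_, ?_, ?_⟩
    · refine Cmd.rep_inv (Q := fun ρ => ∀ X < 2 ^ σ.reg 5, ρ.arr 4 X = σ.arr 4 X +
        if M ≤ band (σ.reg 5) M X then σ.arr 0 (σ.reg 10) else 0)
        -- The condition `X < i` sits inside the summand, so the invariant also records that later
        -- cells are still unchanged.
        (fun i ρ => ∀ X, ρ.arr 4 X = σ.arr 4 X +
          if X < i ∧ M ≤ band (σ.reg 5) M X then σ.arr 0 (σ.reg 10) else 0) ?_ ?_ ?_
      · intro X; simp [ta]
      · intro i ρ hi hF hI X
        have f16 := hF.1 16 (by decide)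
        have f10 := hF.1 10 (by decide)
        have f5 := hF.1 5 (by decide)
        have a0 := hF.2 0 (by decide)
        have e1 : (Ex.reg 16).den (ρ.setReg 13 i) ≤
            (Ex.land (.reg 16) (.reg 13)).den (ρ.setReg 13 i) ↔ M ≤ band (σ.reg 5) M i := by
          simp [Ex.den, f16, t16, f5, tr, band]
        have e2 : (Cmd.store 4 (.reg 13) (.add (.load 4 (.reg 13)) (.load 0 (.reg 10)))).den
            (ρ.setReg 13 i) = (ρ.setReg 13 i).setArr 4 i (ρ.arr 4 i + σ.arr 0 (σ.reg 10)) := by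
          simp [Cmd.den_store, Ex.den, f10, a0, tr, ta]
        rw [Cmd.den_ite_le, e2]
        simp only [e1, Cmd.den_skip]
        have hIX := hI X
        by_cases h1 : M ≤ band (σ.reg 5) M i
        · rw [if_pos h1]
          rcases lt_trichotomy X i with h | rfl | h
          · simp [h.ne, hIX, h, h.trans (Nat.lt_succ_self i)]
          · simp [hIX, h1]
          · simp [h.ne', hIX, h.not_gt, show ¬ X < i + 1 by omega]
        · rw [if_neg h1, State.setReg_arr, hIX]
          congr 1
          refine if_congr ⟨fun h => ⟨by omega, h.2⟩, fun h => ⟨?_, h.2⟩⟩ rfl rfl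
          refine lt_of_le_of_ne (by omega) ?_
          rintro rfl
          exact h1 h.2
      · intro ρ _ hI X hX
        simpa [tr 3 (by omega), h3, hX] using hI X
    · rw [(Cmd.frame _ τ).1 14 (by decide), tr 14 (by omega)]
    · rw [(Cmd.frame _ τ).1 15 (by decide), tr 15 (by omega)]
  · have h0' : ¬ (Ex.const 0).den τ < (Ex.reg 16).den τ := by simpa [Ex.den, t16] using h0
    simp only [if_neg h0', h0, false_and, if_false, not_false_eq_true, if_true]
    refine ⟨by simp [ta], by simp [Ex.den, ta, tr], ?_⟩
    simp [Ex.den, ta, tr]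
    omega

theorem gainTable_den (σ : State) (h3 : σ.reg 3 = 2 ^ σ.reg 5) :
    (∀ X < 2 ^ σ.reg 5, (gainTable.den σ).arr 4 X =
      gain (σ.reg 0) (σ.reg 5) (σ.arr 0) (σ.arr 2) (σ.arr 3) (σ.reg 12) X) ∧
    (gainTable.den σ).reg 14 =
      isoWeight (σ.reg 0) (σ.reg 5) (σ.arr 0) (σ.arr 2) (σ.arr 3) (σ.reg 12) ∧
    (gainTable.den σ).reg 15 =
      isoMax (σ.reg 0) (σ.reg 5) (σ.arr 0) (σ.arr 2) (σ.arr 3) (σ.reg 12) := by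
  have hz : ∀ X < 2 ^ σ.reg 5,
      ((Cmd.rep 13 3 (.store 4 (.reg 13) (.const 0))).den σ).arr 4 X = 0 := by
    refine Cmd.rep_inv (Q := fun τ => ∀ X < 2 ^ σ.reg 5, τ.arr 4 X = 0)
      (fun i τ => ∀ X < i, τ.arr 4 X = 0) (fun X hX => by omega) ?_ ?_
    · intro i τ _ _ hI X hX
      rcases Nat.lt_or_ge X i with h | h
      · simpa [Cmd.den, Ex.den, h.ne] using hI X h
      · obtain rfl : X = i := by omega
        simp [Cmd.den, Ex.den]
    · intro τ _ hI X hX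
      exact hI X (by omega)
  simp only [gainTable, Cmd.den_seq, Cmd.den_set]
  have hF₀ := Cmd.frame (.rep 13 3 (.store 4 (.reg 13) (.const 0))) σ
  set σ₀ := (Cmd.rep 13 3 (.store 4 (.reg 13) (.const 0))).den σ with hσ₀
  clear_value σ₀
  set σ₁ := (σ₀.setReg 14 ((Ex.const 0).den σ₀)).setReg 15
    ((Ex.const 0).den (σ₀.setReg 14 ((Ex.const 0).den σ₀))) with hσ₁
  have s0 : σ₁.reg 0 = σ.reg 0 := by simpa [hσ₁] using hF₀.1 0 (by decide)
  have s3 : σ₁.reg 3 = σ.reg 3 := by simpa [hσ₁] using hF₀.1 3 (by decide)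
  have s5 : σ₁.reg 5 = σ.reg 5 := by simpa [hσ₁] using hF₀.1 5 (by decide)
  have s12 : σ₁.reg 12 = σ.reg 12 := by simpa [hσ₁] using hF₀.1 12 (by decide)
  have s14 : σ₁.reg 14 = 0 := by simp [hσ₁, Ex.den]
  have s15 : σ₁.reg 15 = 0 := by simp [hσ₁, Ex.den]
  have sa0 : σ₁.arr 0 = σ.arr 0 := by simpa [hσ₁] using hF₀.2 0 (by decide)
  have sa2 : σ₁.arr 2 = σ.arr 2 := by simpa [hσ₁] using hF₀.2 2 (by decide)
  have sa3 : σ₁.arr 3 = σ.arr 3 := by simpa [hσ₁] using hF₀.2 3 (by decide)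
  have sa4 : ∀ X < 2 ^ σ.reg 5, σ₁.arr 4 X = 0 := by simpa [hσ₁] using hz
  clear_value σ₁
  refine Cmd.rep_inv (x := 10) (y := 0) (c := gainStep) (σ := σ₁)
    (Q := fun τ => (∀ X < 2 ^ σ.reg 5, τ.arr 4 X =
      gain (σ.reg 0) (σ.reg 5) (σ.arr 0) (σ.arr 2) (σ.arr 3) (σ.reg 12) X) ∧
    τ.reg 14 = isoWeight (σ.reg 0) (σ.reg 5) (σ.arr 0) (σ.arr 2) (σ.arr 3) (σ.reg 12) ∧
    τ.reg 15 = isoMax (σ.reg 0) (σ.reg 5) (σ.arr 0) (σ.arr 2) (σ.arr 3) (σ.reg 12))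
    (fun i τ => (∀ X < 2 ^ σ.reg 5, τ.arr 4 X =
      gain i (σ.reg 5) (σ.arr 0) (σ.arr 2) (σ.arr 3) (σ.reg 12) X) ∧
    τ.reg 14 = isoWeight i (σ.reg 5) (σ.arr 0) (σ.arr 2) (σ.arr 3) (σ.reg 12) ∧
    τ.reg 15 = isoMax i (σ.reg 5) (σ.arr 0) (σ.arr 2) (σ.arr 3) (σ.reg 12)) ?_ ?_ ?_
  · exact ⟨fun X hX => by simp [gain, sa4 X hX], by simp [isoWeight, s14], by simp [isoMax, s15]⟩
  · rintro i τ hi hF ⟨hI1, hI2, hI3⟩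
    have f3 := hF.1 3 (by decide)
    have f5 := hF.1 5 (by decide)
    have f12 := hF.1 12 (by decide)
    have a0 := hF.2 0 (by decide)
    have a2 := hF.2 2 (by decide)
    have a3 := hF.2 3 (by decide)
    have h := gainStep_den (τ.setReg 10 i) (by simp [f3, f5, s3, s5, h3])
    simp [f5, f12, a0, a2, a3, s5, s12, sa0, sa2, sa3] at h
    obtain ⟨h1, h2, h4⟩ := h
    refine ⟨fun X hX => ?_, ?_, ?_⟩
    · rw [h1 X hX, hI1 X hX, gain, gain, Finset.sum_range_succ]
    · rw [h2, hI2, isoWeight, isoWeight, Finset.sum_range_succ]; simp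
    · rw [h4, hI3, isoMax, isoMax, Finset.range_add_one, Finset.sup_insert]; simp
  · rintro τ hF ⟨hI1, hI2, hI3⟩
    rw [s0] at *
    exact ⟨hI1, hI2, hI3⟩

end WVI

/-! ### The search over kept sets and thresholds -/

namespace WVI

open RAM

/-- The algorithm accepts: for some set `Z` of vertices of the cover that are kept and some set
`X`, there is a packing of `Z` by sets of value at most that of `X` that leads to a solution. -/
def Accept (n m k : ℕ) (w pw nb : ℕ → ℕ) : Prop :=
  ∃ Z < 2 ^ m, ∃ X < 2 ^ m, ∃ s,
    Pack m (gain n m w pw nb Z) (gain n m w pw nb Z X) Z s ∧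
      ∑ v ∈ Finset.range n, w v + max (gain n m w pw nb Z X) (isoMax n m w pw nb Z) ≤
        k + s + isoWeight n m w pw nb Z

/-- The table in memory agrees with `gain` only below `2 ^ m`; a packing uses no other sets. -/
theorem Pack.congr {m l Y s : ℕ} {g g' : ℕ → ℕ} (h : Pack m g l Y s)
    (hg : ∀ X < 2 ^ m, g X = g' X) : Pack m g' l Y s := by
  induction h with
  | nil => exact .nil _
  | cons h0 hb hl _ ih =>
    have hlt := hg _ (hb.trans_lt (band_lt _ _ _))
    rw [hlt]
    exact .cons h0 hb (hlt ▸ hl) ih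

/-- Tries the values of all sets as thresholds, for the set `Z` in register `12`. -/
def tryThresholds : Cmd :=
  .rep 13 3 (.seq packTable
    (.ite (.add (.reg 7) (.add (.load 4 (.reg 13)) (.sub (.reg 15) (.load 4 (.reg 13)))))
      (.add (.add (.add (.reg 1) (.load 5 (.reg 12))) (.reg 14)) (.const 1))
      (.set 8 (.const 1)) .skip))

theorem tryThresholds_den (σ : State) (h3 : σ.reg 3 = 2 ^ σ.reg 5) (h4 : σ.arr 4 0 = 0)
    (h8 : σ.reg 8 ≤ 1) (h12 : σ.reg 12 < 2 ^ σ.reg 5) :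
    (tryThresholds.den σ).reg 8 ≤ 1 ∧
    ((tryThresholds.den σ).reg 8 = 1 ↔ σ.reg 8 = 1 ∨ ∃ X < 2 ^ σ.reg 5, ∃ s,
      Pack (σ.reg 5) (σ.arr 4) (σ.arr 4 X) (σ.reg 12) s ∧
        σ.reg 7 + max (σ.arr 4 X) (σ.reg 15) ≤ σ.reg 1 + s + σ.reg 14) := by
  refine Cmd.rep_inv (Q := fun τ => τ.reg 8 ≤ 1 ∧
    (τ.reg 8 = 1 ↔ σ.reg 8 = 1 ∨ ∃ X < 2 ^ σ.reg 5, ∃ s,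
      Pack (σ.reg 5) (σ.arr 4) (σ.arr 4 X) (σ.reg 12) s ∧
        σ.reg 7 + max (σ.arr 4 X) (σ.reg 15) ≤ σ.reg 1 + s + σ.reg 14))
    (fun i τ => τ.reg 8 ≤ 1 ∧ (τ.reg 8 = 1 ↔ σ.reg 8 = 1 ∨ ∃ X < i, ∃ s,
      Pack (σ.reg 5) (σ.arr 4) (σ.arr 4 X) (σ.reg 12) s ∧
        σ.reg 7 + max (σ.arr 4 X) (σ.reg 15) ≤ σ.reg 1 + s + σ.reg 14)) ?_ ?_ ?_
  · simp [h8]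
  · rintro i τ hi hF ⟨hI1, hI2⟩
    have f1 := hF.1 1 (by decide)
    have f3 := hF.1 3 (by decide)
    have f5 := hF.1 5 (by decide)
    have f7 := hF.1 7 (by decide)
    have f12 := hF.1 12 (by decide)
    have f14 := hF.1 14 (by decide)
    have f15 := hF.1 15 (by decide)
    have a4 := hF.2 4 (by decide)
    have hp := packTable_den (τ.setReg 13 i) (by simp [f3, f5, h3]) (by simp [a4, h4])
    have hP := Cmd.frame packTable (τ.setReg 13 i)
    rw [Cmd.den_seq, Cmd.den_ite_le, Cmd.den_skip, Cmd.den_set]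
    set ρ := packTable.den (τ.setReg 13 i)
    simp [f5, a4] at hp
    have g1 := hP.1 1 (by decide)
    have g7 := hP.1 7 (by decide)
    have g8 := hP.1 8 (by decide)
    have g12 := hP.1 12 (by decide)
    have g13 := hP.1 13 (by decide)
    have g14 := hP.1 14 (by decide)
    have g15 := hP.1 15 (by decide)
    have b4 := hP.2 4 (by decide)
    simp [f1, f7, f12, f14, f15, a4] at g1 g7 g8 g12 g13 g14 g15 b4
    clear_value ρ
    have hH := hp _ h12
    -- The packed value occurs on the larger side of the inequality, so testing the largest packing
    -- decides whether any packing works.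
    have e : (Ex.add (.reg 7) (.add (.load 4 (.reg 13)) (.sub (.reg 15) (.load 4 (.reg 13))))).den ρ
        ≤ (Ex.add (.add (.reg 1) (.load 5 (.reg 12))) (.reg 14)).den ρ ↔
        ∃ s, Pack (σ.reg 5) (σ.arr 4) (σ.arr 4 i) (σ.reg 12) s ∧
          σ.reg 7 + max (σ.arr 4 i) (σ.reg 15) ≤ σ.reg 1 + s + σ.reg 14 := by
      simp only [Ex.den, g1, g7, g12, g13, g14, g15, b4]
      rw [show σ.arr 4 i + (σ.reg 15 - σ.arr 4 i) = max (σ.arr 4 i) (σ.reg 15) by omega]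
      constructor
      · exact fun h => ⟨_, hH.1, h⟩
      · rintro ⟨s, hs, h⟩
        have := hH.2 hs
        omega
    have hsplit : ∀ p : ℕ → Prop, (∃ X < i + 1, p X) ↔ (∃ X < i, p X) ∨ p i := fun p => by
      constructor
      · rintro ⟨X, hX, h⟩
        rcases Nat.lt_or_ge X i with hlt | hge
        · exact .inl ⟨X, hlt, h⟩
        · obtain rfl : X = i := by omega
          exact .inr h
      · rintro (⟨X, hX, h⟩ | h)
        exacts [⟨X, by omega, h⟩, ⟨i, by omega, h⟩]
    rw [hsplit]
    split_ifs with hc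
    · rw [e] at hc
      simp [hc, Ex.den]
    · rw [e] at hc
      rw [g8]
      exact ⟨hI1, by simp only [hc, or_false]; exact hI2⟩
  · rintro τ _ hI
    rw [← h3]
    simpa using hI

/-- Computes the neighbourhoods as bit masks in array `3`, the total weight in register `7`, and the
answer for nonnegative `k` in register `8`. -/
def neighborTable : Cmd :=
  .seq (.set 6 (.const 0)) <| .seq (.set 7 (.const 0)) <|
  .rep 10 0 (.seq (.store 3 (.reg 10) (.load 2 (.reg 10))) <|
    .seq (.rep 11 0 (.ite (.const 0) (.load 1 (.add (.reg 6) (.reg 11)))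
      (.store 3 (.reg 10) (.add (.load 3 (.reg 10)) (.load 2 (.reg 11)))) .skip)) <|
    .seq (.set 6 (.add (.reg 6) (.reg 0))) (.set 7 (.add (.reg 7) (.load 0 (.reg 10)))))

/-- The neighbourhoods are closed: the code of `v` itself is included, so that kept cover vertices
are counted by the same rule as the other vertices. Register `6` holds `n * v`, because the machine
has no multiplication. -/
theorem neighborTable_den (σ : State) :
    (∀ v < σ.reg 0, (neighborTable.den σ).arr 3 v = σ.arr 2 v +
      ∑ u ∈ Finset.range (σ.reg 0), if 0 < σ.arr 1 (σ.reg 0 * v + u) then σ.arr 2 u else 0) ∧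
    (neighborTable.den σ).reg 7 = ∑ v ∈ Finset.range (σ.reg 0), σ.arr 0 v := by
  rw [neighborTable, Cmd.den_seq, Cmd.den_seq, Cmd.den_set, Cmd.den_set]
  set σ₁ := (σ.setReg 6 ((Ex.const 0).den σ)).setReg 7
    ((Ex.const 0).den (σ.setReg 6 ((Ex.const 0).den σ))) with hσ₁
  have s0 : σ₁.reg 0 = σ.reg 0 := by simp [hσ₁]
  have s6 : σ₁.reg 6 = 0 := by simp [hσ₁, Ex.den]
  have s7 : σ₁.reg 7 = 0 := by simp [hσ₁, Ex.den]
  have sa : σ₁.arr = σ.arr := by simp [hσ₁]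
  clear_value σ₁
  refine Cmd.rep_inv (Q := fun τ => (∀ v < σ.reg 0, τ.arr 3 v = σ.arr 2 v +
      ∑ u ∈ Finset.range (σ.reg 0), if 0 < σ.arr 1 (σ.reg 0 * v + u) then σ.arr 2 u else 0) ∧
    τ.reg 7 = ∑ v ∈ Finset.range (σ.reg 0), σ.arr 0 v)
    (fun i τ => (∀ v < i, τ.arr 3 v = σ.arr 2 v +
      ∑ u ∈ Finset.range (σ.reg 0), if 0 < σ.arr 1 (σ.reg 0 * v + u) then σ.arr 2 u else 0) ∧
    τ.reg 7 = ∑ v ∈ Finset.range i, σ.arr 0 v ∧ τ.reg 6 = σ.reg 0 * i) ?_ ?_ ?_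
  · simp [s6, s7]
  · rintro i τ hi hF ⟨hI1, hI2, hI3⟩
    have f0 := (hF.1 0 (by decide)).trans s0
    have a0 := hF.2 0 (by decide)
    have a1 := hF.2 1 (by decide)
    have a2 := hF.2 2 (by decide)
    rw [sa] at a0 a1 a2
    rw [Cmd.den_seq, Cmd.den_seq, Cmd.den_seq, Cmd.den_store, Cmd.den_set, Cmd.den_set]
    set ρ := (τ.setReg 10 i).setArr 3 ((Ex.reg 10).den (τ.setReg 10 i))
      ((Ex.load 2 (.reg 10)).den (τ.setReg 10 i)) with hρ
    have r0 : ρ.reg 0 = σ.reg 0 := by simp [hρ, f0]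
    have r6 : ρ.reg 6 = σ.reg 0 * i := by simp [hρ, hI3]
    have r7 : ρ.reg 7 = ∑ v ∈ Finset.range i, σ.arr 0 v := by simp [hρ, hI2]
    have r10 : ρ.reg 10 = i := by simp [hρ]
    have b0 : ρ.arr 0 = σ.arr 0 := by ext; simp [hρ, a0]
    have b1 : ρ.arr 1 = σ.arr 1 := by ext; simp [hρ, a1]
    have b2 : ρ.arr 2 = σ.arr 2 := by ext; simp [hρ, a2]
    have b3 : ρ.arr 3 i = σ.arr 2 i := by simp [hρ, Ex.den, a2]
    have b3' : ∀ v < i, ρ.arr 3 v = τ.arr 3 v := fun v hv => by simp [hρ, Ex.den, hv.ne]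
    clear_value ρ
    refine Cmd.rep_inv (σ := ρ) (Q := fun κ =>
      (∀ v < i + 1, ((κ.setReg 6 ((Ex.add (.reg 6) (.reg 0)).den κ)).setReg 7 _).arr 3 v =
        σ.arr 2 v + ∑ u ∈ Finset.range (σ.reg 0),
          if 0 < σ.arr 1 (σ.reg 0 * v + u) then σ.arr 2 u else 0) ∧
      ((κ.setReg 6 ((Ex.add (.reg 6) (.reg 0)).den κ)).setReg 7
        ((Ex.add (.reg 7) (.load 0 (.reg 10))).den
          (κ.setReg 6 ((Ex.add (.reg 6) (.reg 0)).den κ)))).reg 7 =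
        ∑ v ∈ Finset.range (i + 1), σ.arr 0 v ∧
      ((κ.setReg 6 ((Ex.add (.reg 6) (.reg 0)).den κ)).setReg 7 _).reg 6 = σ.reg 0 * (i + 1))
      (fun j κ => (∀ v < i, κ.arr 3 v = τ.arr 3 v) ∧ κ.arr 3 i = σ.arr 2 i +
        ∑ u ∈ Finset.range j, if 0 < σ.arr 1 (σ.reg 0 * i + u) then σ.arr 2 u else 0) ?_ ?_ ?_
    · simpa [b3] using b3'
    · rintro j κ hj hG ⟨hJ1, hJ2⟩
      have g6 := (hG.1 6 (by decide)).trans r6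
      have g10 := (hG.1 10 (by decide)).trans r10
      have c1 := (hG.2 1 (by decide)).trans b1
      have c2 := (hG.2 2 (by decide)).trans b2
      have e : (Ex.const 0).den (κ.setReg 11 j) <
          (Ex.load 1 (.add (.reg 6) (.reg 11))).den (κ.setReg 11 j) ↔
          0 < σ.arr 1 (σ.reg 0 * i + j) := by
        simp [Ex.den, g6, c1]
      rw [Cmd.den_ite, Cmd.den_skip]
      simp only [e]
      rw [Finset.sum_range_succ]
      split_ifs with hc
      · refine ⟨fun v hv => ?_, ?_⟩
        · simpa [Cmd.den_store, Ex.den, g10, hv.ne] using hJ1 v hv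
        · simp [Cmd.den_store, Ex.den, g10, hJ2, c2, add_assoc]
      · exact ⟨hJ1, by simp [hJ2]⟩
    · rintro κ hG ⟨hJ1, hJ2⟩
      have g0 := (hG.1 0 (by decide)).trans r0
      have g6 := (hG.1 6 (by decide)).trans r6
      have g7 := (hG.1 7 (by decide)).trans r7
      have g10 := (hG.1 10 (by decide)).trans r10
      have c0 := (hG.2 0 (by decide)).trans b0
      rw [r0] at hJ2
      refine ⟨fun v hv => ?_, ?_, ?_⟩
      · rcases Nat.lt_or_ge v i with hlt | hge
        · simpa [hJ1 v hlt] using hI1 v hlt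
        · obtain rfl : v = i := by omega
          simpa using hJ2
      · simp [Ex.den, g7, g10, c0, Finset.sum_range_succ]
      · simp [Ex.den, g0, g6, mul_add]
  · rintro τ _ ⟨hI1, hI2, -⟩
    rw [s0] at *
    exact ⟨hI1, by simpa using hI2⟩

/-- The main loop, over the sets `Z` of vertices of the cover that are kept. -/
def tryKept : Cmd :=
  .seq (.set 8 (.const 0)) (.rep 12 3 (.seq gainTable tryThresholds))

/-- The empty set gains nothing because counted vertices must have a neighbour, or be themselves, in
`Z`. -/
theorem gain_zero (n m : ℕ) (w pw nb : ℕ → ℕ) (Z : ℕ) : gain n m w pw nb Z 0 = 0 := by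
  refine Finset.sum_eq_zero fun v _ => if_neg ?_
  rintro ⟨-, h0, h⟩
  have := h.trans (band_le_right _ _ _)
  omega

theorem tryKept_den (σ : State) (h3 : σ.reg 3 = 2 ^ σ.reg 5)
    (h7 : σ.reg 7 = ∑ v ∈ Finset.range (σ.reg 0), σ.arr 0 v) :
    (tryKept.den σ).reg 8 ≤ 1 ∧ ((tryKept.den σ).reg 8 = 1 ↔
      Accept (σ.reg 0) (σ.reg 5) (σ.reg 1) (σ.arr 0) (σ.arr 2) (σ.arr 3)) := by
  rw [tryKept, Cmd.den_seq, Cmd.den_set]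
  set σ₁ := σ.setReg 8 ((Ex.const 0).den σ) with hσ₁
  have s8 : σ₁.reg 8 = 0 := by simp [hσ₁, Ex.den]
  have sr : ∀ r < 8, σ₁.reg r = σ.reg r := fun r hr => by simp [hσ₁, hr.ne]
  have sa : σ₁.arr = σ.arr := rfl
  clear_value σ₁
  refine Cmd.rep_inv (σ := σ₁) (Q := fun τ => τ.reg 8 ≤ 1 ∧ (τ.reg 8 = 1 ↔
      Accept (σ.reg 0) (σ.reg 5) (σ.reg 1) (σ.arr 0) (σ.arr 2) (σ.arr 3)))
    (fun i τ => τ.reg 8 ≤ 1 ∧ (τ.reg 8 = 1 ↔ ∃ Z < i, ∃ X < 2 ^ σ.reg 5, ∃ s,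
      Pack (σ.reg 5) (gain (σ.reg 0) (σ.reg 5) (σ.arr 0) (σ.arr 2) (σ.arr 3) Z)
        (gain (σ.reg 0) (σ.reg 5) (σ.arr 0) (σ.arr 2) (σ.arr 3) Z X) Z s ∧
      ∑ v ∈ Finset.range (σ.reg 0), σ.arr 0 v +
        max (gain (σ.reg 0) (σ.reg 5) (σ.arr 0) (σ.arr 2) (σ.arr 3) Z X)
          (isoMax (σ.reg 0) (σ.reg 5) (σ.arr 0) (σ.arr 2) (σ.arr 3) Z) ≤
        σ.reg 1 + s + isoWeight (σ.reg 0) (σ.reg 5) (σ.arr 0) (σ.arr 2) (σ.arr 3) Z)) ?_ ?_ ?_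
  · simp [s8]
  · rintro i τ hi hF ⟨hI1, hI2⟩
    have f0 := (hF.1 0 (by decide)).trans (sr 0 (by omega))
    have f1 := (hF.1 1 (by decide)).trans (sr 1 (by omega))
    have f3 := (hF.1 3 (by decide)).trans (sr 3 (by omega))
    have f5 := (hF.1 5 (by decide)).trans (sr 5 (by omega))
    have f7 := (hF.1 7 (by decide)).trans (sr 7 (by omega))
    have a0 := hF.2 0 (by decide)
    have a2 := hF.2 2 (by decide)
    have a3 := hF.2 3 (by decide)
    rw [sa] at a0 a2 a3
    rw [sr 3 (by omega), h3] at hi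
    rw [Cmd.den_seq]
    have hg := gainTable_den (τ.setReg 12 i) (by simp [f3, f5, h3])
    have hG := Cmd.frame gainTable (τ.setReg 12 i)
    set ρ := gainTable.den (τ.setReg 12 i)
    simp [f5, f0, a0, a2, a3] at hg
    obtain ⟨hg4, hg14, hg15⟩ := hg
    have g1 := hG.1 1 (by decide)
    have g3 := hG.1 3 (by decide)
    have g5 := hG.1 5 (by decide)
    have g7 := hG.1 7 (by decide)
    have g8 := hG.1 8 (by decide)
    have g12 := hG.1 12 (by decide)
    simp [f1, f3, f5, f7] at g1 g3 g5 g7 g8 g12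
    clear_value ρ
    have ht := tryThresholds_den ρ (by rw [g3, g5, h3])
      (by rw [hg4 0 (by positivity), gain_zero]) (by rw [g8]; exact hI1) (by rw [g12, g5]; exact hi)
    refine ⟨ht.1, ht.2.trans ?_⟩
    rw [g8, hI2, g5, g12, g1, g7, h7, hg14, hg15]
    -- Replaces the tabulated values by `gain` itself.
    have hstep : ∀ X < 2 ^ σ.reg 5, ∀ s, Pack (σ.reg 5) (ρ.arr 4) (ρ.arr 4 X) i s ↔
        Pack (σ.reg 5) (gain (σ.reg 0) (σ.reg 5) (σ.arr 0) (σ.arr 2) (σ.arr 3) i)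
          (gain (σ.reg 0) (σ.reg 5) (σ.arr 0) (σ.arr 2) (σ.arr 3) i X) i s := by
      intro X hX s
      rw [hg4 X hX]
      exact ⟨fun h => h.congr hg4, fun h => h.congr fun Y hY => (hg4 Y hY).symm⟩
    constructor
    · rintro (⟨Z, hZ, h⟩ | ⟨X, hX, s, hs, h⟩)
      · exact ⟨Z, by omega, h⟩
      · rw [hstep X hX s] at hs
        rw [hg4 X hX] at h
        exact ⟨i, by omega, X, hX, s, hs, h⟩
    · rintro ⟨Z, hZ, X, hX, s, hs, h⟩
      rcases Nat.lt_or_ge Z i with hlt | hge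
      · exact .inl ⟨Z, hlt, X, hX, s, hs, h⟩
      · obtain rfl : Z = i := by omega
        refine .inr ⟨X, hX, s, (hstep X hX s).2 hs, ?_⟩
        rw [hg4 X hX]
        exact h
  · rintro τ _ hI
    rw [sr 3 (by omega), h3] at hI
    simpa [Accept] using hI

end WVI

/-! ### A maximal matching and its code -/

namespace WVI

open RAM

/-- The nonzero values of `pw` are the different powers `2 ^ i` with `i < m`, at the vertices of a
set that is the union of the edges of a matching. -/
structure MatchingCode (n : ℕ) (adj : ℕ → ℕ → Prop) (pw : ℕ → ℕ) (m : ℕ) : Prop where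
  lt : ∀ v, pw v ≠ 0 → v < n
  pow : ∀ v, pw v ≠ 0 → ∃ i < m, pw v = 2 ^ i
  inj : ∀ u v, pw u ≠ 0 → pw u = pw v → u = v
  le : ∀ K : Finset ℕ, (∀ u v, adj u v → u ∈ K ∨ v ∈ K) →
    m ≤ 2 * (K.filter fun v => pw v ≠ 0).card

/-- The new edge receives the two fresh bits `m` and `m + 1`. A vertex cover `K` contains an end of
it, and that end was unmatched before, so the matched part of `K` grows by at least one while `m`
grows by two. -/
theorem MatchingCode.add {n m i j : ℕ} {adj : ℕ → ℕ → Prop} {pw pw' : ℕ → ℕ}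
    (h : MatchingCode n adj pw m) (hin : i < n) (hjn : j < n) (hij : adj i j) (hne : i ≠ j)
    (hi : pw i = 0) (hj : pw j = 0)
    (hpi : pw' i = 2 ^ m) (hpj : pw' j = 2 ^ (m + 1)) (hp : ∀ v, v ≠ i → v ≠ j → pw' v = pw v) :
    MatchingCode n adj pw' (m + 2) := by
  have hlt : ∀ v, v ≠ i → v ≠ j → pw v ≠ 0 → pw' v < 2 ^ m := by
    intro v hvi hvj hv
    obtain ⟨a, ha, hav⟩ := h.pow v hv
    rw [hp v hvi hvj, hav]
    exact Nat.pow_lt_pow_right (by omega) ha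
  have hm : 0 < 2 ^ m := by positivity
  have hm' : 2 ^ (m + 1) = 2 * 2 ^ m := by ring
  refine ⟨fun v hv => ?_, fun v hv => ?_, fun u v hu huv => ?_, fun K hK => ?_⟩
  · by_cases hvi : v = i
    · exact hvi ▸ hin
    by_cases hvj : v = j
    · exact hvj ▸ hjn
    exact h.lt v (by rwa [← hp v hvi hvj])
  · by_cases hvi : v = i
    · exact ⟨m, by omega, hvi ▸ hpi⟩
    by_cases hvj : v = j
    · exact ⟨m + 1, by omega, hvj ▸ hpj⟩
    rw [hp v hvi hvj] at hv ⊢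
    obtain ⟨a, ha, hav⟩ := h.pow v hv
    exact ⟨a, by omega, hav⟩
  · have key : ∀ u v, u ≠ i → u ≠ j → pw' u ≠ 0 → pw' u = pw' v → u = v := by
      intro u v hui huj hu huv
      rw [hp u hui huj] at hu
      have := hlt u hui huj hu
      have hvi : v ≠ i := by rintro rfl; omega
      have hvj : v ≠ j := by rintro rfl; omega
      rw [hp u hui huj, hp v hvi hvj] at huv
      exact h.inj u v hu huv
    by_cases h1 : u ≠ i ∧ u ≠ j
    · exact key u v h1.1 h1.2 hu huv
    by_cases h2 : v ≠ i ∧ v ≠ j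
    · exact (key v u h2.1 h2.2 (huv ▸ hu) huv.symm).symm
    have h1' : u = i ∨ u = j := by tauto
    have h2' : v = i ∨ v = j := by tauto
    rcases h1' with rfl | rfl <;> rcases h2' with rfl | rfl <;> first | rfl | omega
  · have hk := h.le K hK
    have hsub : ∃ x ∈ K, pw x = 0 ∧ pw' x ≠ 0 := by
      rcases hK i j hij with hx | hx
      · exact ⟨i, hx, hi, by omega⟩
      · exact ⟨j, hx, hj, by omega⟩
    obtain ⟨x, hxK, hx, hx'⟩ := hsub
    -- The inclusion is strict: `x` is newly matched, and no vertex loses its code.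
    have hss : (K.filter fun v => pw v ≠ 0) ⊂ K.filter fun v => pw' v ≠ 0 := by
      refine Finset.ssubset_iff_of_subset (fun v hv => ?_) |>.2
        ⟨x, by simp [hxK, hx'], by simp [hx]⟩
      simp only [Finset.mem_filter] at hv ⊢
      refine ⟨hv.1, ?_⟩
      rw [hp v (by rintro rfl; exact hv.2 hi) (by rintro rfl; exact hv.2 hj)]
      exact hv.2
    have := Finset.card_lt_card hss
    omega

/-- Adds the edge of the vertices `10` and `11` to the matching, if that is possible. -/
def matchStep : Cmd :=
  .ite (.const 0) (.load 1 (.add (.reg 6) (.reg 11)))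
    (.ite (.add (.load 2 (.reg 10)) (.load 2 (.reg 11))) (.const 1)
      (.seq (.store 2 (.reg 10) (.reg 3)) <| .seq (.store 2 (.reg 11) (.add (.reg 3) (.reg 3))) <|
        .seq (.set 5 (.add (.reg 5) (.const 2)))
          (.set 3 (.add (.add (.reg 3) (.reg 3)) (.add (.reg 3) (.reg 3)))))
      .skip) .skip

/-- Computes a maximal matching. -/
def matching : Cmd :=
  .seq (.set 3 (.const 1)) (.rep 10 0 (.seq (.rep 11 0 matchStep) (.set 6 (.add (.reg 6) (.reg 0)))))

/-- The adjacency relation in array `1`. -/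
def adjOf (σ : State) (i j : ℕ) : Prop := i < σ.reg 0 ∧ j < σ.reg 0 ∧ 0 < σ.arr 1 (σ.reg 0 * i + j)

theorem matchStep_den (σ : State) (adj : ℕ → ℕ → Prop) (h3 : σ.reg 3 = 2 ^ σ.reg 5)
    (hadj : 0 < σ.arr 1 (σ.reg 6 + σ.reg 11) ↔ adj (σ.reg 10) (σ.reg 11))
    (hne : adj (σ.reg 10) (σ.reg 11) → σ.reg 10 ≠ σ.reg 11)
    (hi : σ.reg 10 < σ.reg 0) (hj : σ.reg 11 < σ.reg 0)
    (hM : MatchingCode (σ.reg 0) adj (σ.arr 2) (σ.reg 5)) :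
    (matchStep.den σ).reg 3 = 2 ^ (matchStep.den σ).reg 5 ∧
    MatchingCode (σ.reg 0) adj ((matchStep.den σ).arr 2) ((matchStep.den σ).reg 5) ∧
    (∀ v, σ.arr 2 v ≠ 0 → (matchStep.den σ).arr 2 v ≠ 0) ∧
    (adj (σ.reg 10) (σ.reg 11) →
      (matchStep.den σ).arr 2 (σ.reg 10) ≠ 0 ∨ (matchStep.den σ).arr 2 (σ.reg 11) ≠ 0) := by
  have e1 : (Ex.const 0).den σ < (Ex.load 1 (.add (.reg 6) (.reg 11))).den σ ↔
      adj (σ.reg 10) (σ.reg 11) := by simpa [Ex.den] using hadj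
  have e2 : (Ex.add (.load 2 (.reg 10)) (.load 2 (.reg 11))).den σ < (Ex.const 1).den σ ↔
      σ.arr 2 (σ.reg 10) = 0 ∧ σ.arr 2 (σ.reg 11) = 0 := by simp [Ex.den]
  rw [matchStep, Cmd.den_ite, Cmd.den_ite]
  by_cases hc1 : adj (σ.reg 10) (σ.reg 11)
  swap
  · rw [if_neg (by rwa [e1])]
    exact ⟨h3, hM, fun _ h => h, fun h => absurd h hc1⟩
  rw [if_pos (by rwa [e1])]
  by_cases hc2 : σ.arr 2 (σ.reg 10) = 0 ∧ σ.arr 2 (σ.reg 11) = 0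
  swap
  · rw [if_neg (by rwa [e2])]
    exact ⟨h3, hM, fun _ h => h, fun _ => by rw [Cmd.den_skip]; tauto⟩
  rw [if_pos (by rwa [e2])]
  have hij := hne hc1
  have h3pos : 0 < σ.reg 3 := by rw [h3]; positivity
  refine ⟨?_, ?_, ?_, ?_⟩
  · simp [Cmd.den, Ex.den, h3, pow_succ]; ring
  · have e5 : ∀ x, σ.reg 5 + 2 = x → MatchingCode (σ.reg 0) adj
      (((Cmd.seq (.store 2 (.reg 10) (.reg 3)) <|
        .seq (.store 2 (.reg 11) (.add (.reg 3) (.reg 3))) <|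
        .seq (.set 5 (.add (.reg 5) (.const 2)))
          (.set 3 (.add (.add (.reg 3) (.reg 3)) (.add (.reg 3) (.reg 3))))).den σ).arr 2) x := by
      rintro _ rfl
      refine hM.add hi hj hc1 hij hc2.1 hc2.2 ?_ ?_ ?_
      · simp [Cmd.den, Ex.den, hij, h3]
      · simp [Cmd.den, Ex.den, h3, pow_succ, mul_two]
      · intro v hv hv'
        simp [Cmd.den, Ex.den, hv, hv']
    exact e5 _ (by simp [Cmd.den, Ex.den])
  · intro v hv
    by_cases h1 : v = σ.reg 11
    · simp [Cmd.den, Ex.den, h1]; omega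
    by_cases h2 : v = σ.reg 10
    · simp [Cmd.den, Ex.den, h2, hij]; omega
    simpa [Cmd.den, Ex.den, h1, h2] using hv
  · intro _
    right
    simp [Cmd.den, Ex.den]; omega

/-- Greedy choice gives maximality: once an edge has been examined one of its ends is matched, and
codes never return to zero. The matched vertices therefore cover all edges. -/
theorem matching_den (σ : State) (h2 : ∀ v, σ.arr 2 v = 0) (h5 : σ.reg 5 = 0) (h6 : σ.reg 6 = 0)
    (hirr : ∀ i, ¬ adjOf σ i i) :
    (matching.den σ).reg 3 = 2 ^ (matching.den σ).reg 5 ∧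
    MatchingCode (σ.reg 0) (adjOf σ) ((matching.den σ).arr 2) ((matching.den σ).reg 5) ∧
    ∀ i j, adjOf σ i j → (matching.den σ).arr 2 i ≠ 0 ∨ (matching.den σ).arr 2 j ≠ 0 := by
  rw [matching, Cmd.den_seq, Cmd.den_set]
  set σ₁ := σ.setReg 3 ((Ex.const 1).den σ) with hσ₁
  have s0 : σ₁.reg 0 = σ.reg 0 := by simp [hσ₁]
  have s3 : σ₁.reg 3 = 1 := by simp [hσ₁, Ex.den]
  have s5 : σ₁.reg 5 = 0 := by simp [hσ₁, h5]
  have s6 : σ₁.reg 6 = 0 := by simp [hσ₁, h6]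
  have sa : σ₁.arr = σ.arr := rfl
  clear_value σ₁
  refine Cmd.rep_inv (σ := σ₁) (Q := fun τ => τ.reg 3 = 2 ^ τ.reg 5 ∧
      MatchingCode (σ.reg 0) (adjOf σ) (τ.arr 2) (τ.reg 5) ∧
      ∀ i j, adjOf σ i j → τ.arr 2 i ≠ 0 ∨ τ.arr 2 j ≠ 0)
    (fun i τ => τ.reg 6 = σ.reg 0 * i ∧ τ.reg 3 = 2 ^ τ.reg 5 ∧
      MatchingCode (σ.reg 0) (adjOf σ) (τ.arr 2) (τ.reg 5) ∧
      ∀ a < i, ∀ b, adjOf σ a b → τ.arr 2 a ≠ 0 ∨ τ.arr 2 b ≠ 0) ?_ ?_ ?_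
  · refine ⟨by simp [s6], by simp [s3, s5], ?_, by simp⟩
    rw [sa, s5]
    exact ⟨by simp [h2], by simp [h2], by simp [h2], by simp⟩
  · rintro i τ hi hF ⟨hI0, hI1, hI2, hI3⟩
    have f0 := (hF.1 0 (by decide)).trans s0
    have a1 := hF.2 1 (by decide)
    rw [sa] at a1
    rw [s0] at hi
    rw [Cmd.den_seq, Cmd.den_set]
    refine Cmd.rep_inv (σ := τ.setReg 10 i) (Q := fun κ =>
      (κ.setReg 6 ((Ex.add (.reg 6) (.reg 0)).den κ)).reg 6 = σ.reg 0 * (i + 1) ∧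
      (κ.setReg 6 ((Ex.add (.reg 6) (.reg 0)).den κ)).reg 3 =
        2 ^ (κ.setReg 6 ((Ex.add (.reg 6) (.reg 0)).den κ)).reg 5 ∧
      MatchingCode (σ.reg 0) (adjOf σ) ((κ.setReg 6 ((Ex.add (.reg 6) (.reg 0)).den κ)).arr 2)
        ((κ.setReg 6 ((Ex.add (.reg 6) (.reg 0)).den κ)).reg 5) ∧
      ∀ a < i + 1, ∀ b, adjOf σ a b →
        (κ.setReg 6 ((Ex.add (.reg 6) (.reg 0)).den κ)).arr 2 a ≠ 0 ∨
        (κ.setReg 6 ((Ex.add (.reg 6) (.reg 0)).den κ)).arr 2 b ≠ 0)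
      (fun j κ => κ.reg 3 = 2 ^ κ.reg 5 ∧
        MatchingCode (σ.reg 0) (adjOf σ) (κ.arr 2) (κ.reg 5) ∧
        (∀ a < i, ∀ b, adjOf σ a b → κ.arr 2 a ≠ 0 ∨ κ.arr 2 b ≠ 0) ∧
        ∀ b < j, adjOf σ i b → κ.arr 2 i ≠ 0 ∨ κ.arr 2 b ≠ 0) ?_ ?_ ?_
    · exact ⟨by simpa using hI1, by simpa using hI2, by simpa using hI3, by simp⟩
    · rintro j κ hj hG ⟨hJ1, hJ2, hJ3, hJ4⟩
      have g0 := hG.1 0 (by decide)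
      have g6 := hG.1 6 (by decide)
      have g10 := hG.1 10 (by decide)
      have c1 := hG.2 1 (by decide)
      simp [f0, a1, hI0] at g0 g6 g10 c1 hj
      have hs := matchStep_den (κ.setReg 11 j) (adjOf σ) (by simpa using hJ1)
        (by simp [adjOf, g6, g10, c1, hi, hj])
        (by simp only [State.setReg_reg]
            simp only [g10]
            intro h
            norm_num at h ⊢
            rintro rfl
            exact hirr _ h)
        (by simp [g10, g0, hi]) (by simp [g0, hj]) (by simpa [g0] using hJ2)
      simp [g10, g0] at hs
      obtain ⟨t1, t2, t3, t4⟩ := hs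
      refine ⟨t1, t2, fun a ha b hab => ?_, fun b hb hib => ?_⟩
      · exact (hJ3 a ha b hab).imp (t3 a) (t3 b)
      · rcases Nat.lt_or_ge b j with hlt | hge
        · exact (hJ4 b hlt hib).imp (t3 i) (t3 b)
        · obtain rfl : b = j := by omega
          have := t4 hib
          tauto
    · rintro κ hG ⟨hJ1, hJ2, hJ3, hJ4⟩
      have g0 := hG.1 0 (by decide)
      have g6 := hG.1 6 (by decide)
      simp [f0, hI0] at g0 g6
      simp [f0] at hJ4
      refine ⟨by simp [Ex.den, g0, g6, mul_add], by simpa using hJ1, by simpa using hJ2, ?_⟩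
      intro a ha b hab
      rcases Nat.lt_or_ge a i with hlt | hge
      · simpa using hJ3 a hlt b hab
      · obtain rfl : a = i := by omega
        have := hJ4 b hab.2.1 hab
        simp; tauto
  · rintro τ _ ⟨-, hI1, hI2, hI3⟩
    rw [s0] at *
    exact ⟨by simpa using hI1, by simpa using hI2, fun i j hij => by
      simpa using hI3 i hij.1 j hij⟩

end WVI

/-! ## Vertex integrity by labellings -/

namespace WVI

/-- The labels are constant on the components of `G - S`, and the weight of the vertices with the
same label is at most `L`. -/
structure IsLabelling {V : Type*} [Fintype V] [DecidableEq V] (G : SimpleGraph V) (w : V → ℕ+)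
    (S : Finset V) (c : V → ℕ) (L : ℕ) : Prop where
  adj : ∀ u v, u ∉ S → v ∉ S → G.Adj u v → c u = c v
  le : ∀ a, weight w (Finset.univ.filter fun v => v ∉ S ∧ c v = a) ≤ L

theorem weight_mono {V : Type*} (w : V → ℕ+) {S T : Finset V} (h : S ⊆ T) :
    weight w S ≤ weight w T :=
  Finset.sum_le_sum_of_subset h

theorem mem_componentVerts {V : Type*} [Fintype V] {G : SimpleGraph V} {S : Finset V}
    {D : (deleteVerts G S).ConnectedComponent} {v : V} :
    v ∈ componentVerts G S D ↔ ∃ h : v ∉ S, (deleteVerts G S).connectedComponentMk ⟨v, h⟩ = D := by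
  simp [componentVerts, SimpleGraph.ConnectedComponent.mem_supp_iff]

theorem weight_component_le {V : Type*} [Fintype V] (G : SimpleGraph V) (w : V → ℕ+)
    (S : Finset V) (D : (deleteVerts G S).ConnectedComponent) :
    weight w (componentVerts G S D) ≤ maxComponentWeight G w S := by
  let := Fintype.ofFinite (deleteVerts G S).ConnectedComponent
  exact Finset.le_sup (f := fun D => weight w (componentVerts G S D)) (Finset.mem_univ D)

/-- A label class is a union of components, so its weight bounds theirs; conversely, numbering the
components is a labelling. Labels avoid connectivity in the rest of the argument, and `L` need only
be an upper bound. -/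
theorem wvi_le_iff {V : Type*} [Fintype V] [DecidableEq V] (G : SimpleGraph V) (w : V → ℕ+)
    (k : ℕ) : wvi G w ≤ k ↔ ∃ S c L, IsLabelling G w S c L ∧ weight w S + L ≤ k := by
  classical
  constructor
  · intro h
    obtain ⟨S, -, hS⟩ := Finset.exists_mem_eq_inf' (s := (Finset.univ : Finset (Finset V)))
      Finset.univ_nonempty fun S => weight w S + maxComponentWeight G w S
    let f := Finite.equivFin (deleteVerts G S).ConnectedComponent
    refine ⟨S, fun v => if hv : v ∉ S then
      (f ((deleteVerts G S).connectedComponentMk ⟨v, hv⟩) : ℕ) else 0,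
      maxComponentWeight G w S, ⟨?_, ?_⟩, ?_⟩
    · intro u v hu hv huv
      simp only [hu, hv, not_false_eq_true, dif_pos]
      congr 2
      refine SimpleGraph.ConnectedComponent.sound (SimpleGraph.Adj.reachable ?_)
      simpa using huv
    · intro a
      rcases Finset.eq_empty_or_nonempty (Finset.univ.filter fun v => v ∉ S ∧
        (if hv : v ∉ S then (f ((deleteVerts G S).connectedComponentMk ⟨v, hv⟩) : ℕ) else 0) = a)
        with he | ⟨x, hx⟩
      · rw [he]; simp [weight]
      · simp only [Finset.mem_filter, Finset.mem_univ, true_and] at hx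
        obtain ⟨hxS, hxa⟩ := hx
        rw [dif_pos hxS] at hxa
        refine le_trans (weight_mono w fun v hv => ?_)
          (weight_component_le G w S ((deleteVerts G S).connectedComponentMk ⟨x, hxS⟩))
        simp only [Finset.mem_filter, Finset.mem_univ, true_and] at hv
        obtain ⟨hvS, hva⟩ := hv
        rw [dif_pos hvS, ← hxa] at hva
        exact mem_componentVerts.2 ⟨hvS, f.injective (Fin.ext hva)⟩
    · exact hS ▸ h
  · rintro ⟨S, c, L, hc, hk⟩
    refine (Finset.inf'_le _ (Finset.mem_univ S)).trans (le_trans ?_ hk)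
    refine Nat.add_le_add_left (Finset.sup_le fun D _ => ?_) _
    obtain ⟨⟨x, hx⟩, rfl⟩ := D.exists_rep
    refine (weight_mono w fun v hv => ?_).trans (hc.le (c x))
    obtain ⟨hvS, hv⟩ := mem_componentVerts.1 hv
    simp only [Finset.mem_filter, Finset.mem_univ, true_and]
    refine ⟨hvS, ?_⟩
    obtain ⟨p⟩ := SimpleGraph.ConnectedComponent.exact hv
    have H : ∀ (a b : {v : V // v ∉ S}), (deleteVerts G S).Walk a b → c a = c b := by
      intro a b p
      induction p with
      | nil => rfl
      | @cons x y _ h _ ih => exact (hc.adj x y x.2 y.2 (by simpa using h)).trans ih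
    exact H _ _ p

/-- There is an optimal deletion set such that every deleted vertex joins different labels. -/
theorem exists_irredundant {V : Type*} [Fintype V] [DecidableEq V] {G : SimpleGraph V}
    {w : V → ℕ+} {k : ℕ} (h : wvi G w ≤ k) : ∃ S c L, IsLabelling G w S c L ∧
      weight w S + L ≤ k ∧ ∀ v ∈ S, ∃ x y, x ∉ S ∧ y ∉ S ∧ G.Adj v x ∧ G.Adj v y ∧ c x ≠ c y := by
  classical
  -- Among the deletion sets that meet the bound `k`, one of least cardinality is chosen.
  have hex : ∃ d, ∃ S c L, IsLabelling G w S c L ∧ weight w S + L ≤ k ∧ S.card = d := by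
    obtain ⟨S, c, L, h, hk⟩ := (wvi_le_iff G w k).1 h
    exact ⟨_, S, c, L, h, hk, rfl⟩
  obtain ⟨S, c, L, hL, hk, hd⟩ := Nat.find_spec hex
  refine ⟨S, c, L, hL, hk, fun v hv => ?_⟩
  by_contra! hcon
  -- If no remaining neighbour exists, any label does; `0` is taken, even if it is already in use.
  obtain ⟨a, ha⟩ : ∃ a, ∀ x, x ∉ S → G.Adj v x → c x = a := by
    by_cases hx : ∃ x, x ∉ S ∧ G.Adj v x
    · obtain ⟨x, hxS, hx⟩ := hx
      exact ⟨c x, fun y hyS hy => hcon y x hyS hxS hy hx⟩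
    · exact ⟨0, fun x hxS hx' => absurd ⟨x, hxS, hx'⟩ hx⟩
  have hw : weight w (S.erase v) + w v = weight w S := Finset.sum_erase_add _ _ hv
  -- Returning `v` with label `a` lowers the deleted weight by `w v` and raises the bound by `w v`.
  refine Nat.find_min hex (m := (S.erase v).card) (hd ▸ Finset.card_erase_lt_of_mem hv)
    ⟨S.erase v, Function.update c v a, L + w v, ⟨?_, ?_⟩, by omega, rfl⟩
  · intro x y hx hy hxy
    have hmem : ∀ z, z ∉ S.erase v → z ≠ v → z ∉ S := fun z hz hzv hzS =>
      hz (Finset.mem_erase.2 ⟨hzv, hzS⟩)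
    by_cases hxv : x = v
    · subst hxv
      have hyx : y ≠ x := hxy.ne'
      rw [Function.update_self, Function.update_of_ne hyx, ha y (hmem y hy hyx) hxy]
    · rw [Function.update_of_ne hxv]
      by_cases hyv : y = v
      · subst hyv
        rw [Function.update_self, ha x (hmem x hx hxv) hxy.symm]
      · rw [Function.update_of_ne hyv, hL.adj x y (hmem x hx hxv) (hmem y hy hyv) hxy]
  · intro b
    have hsub : (Finset.univ.filter fun x => x ∉ S.erase v ∧ Function.update c v a x = b) ⊆
        insert v (Finset.univ.filter fun x => x ∉ S ∧ c x = b) := by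
      intro x hx
      simp only [Finset.mem_filter, Finset.mem_univ, true_and, Finset.mem_insert] at hx ⊢
      by_cases hxv : x = v
      · exact .inl hxv
      · rw [Function.update_of_ne hxv] at hx
        exact .inr ⟨fun hxS => hx.1 (Finset.mem_erase.2 ⟨hxv, hxS⟩), hx.2⟩
    refine (weight_mono w hsub).trans ?_
    have hb := hL.le b
    have : weight w (insert v (Finset.univ.filter fun x => x ∉ S ∧ c x = b)) =
        w v + weight w (Finset.univ.filter fun x => x ∉ S ∧ c x = b) :=
      Finset.sum_insert (by simp [hv])
    omega

/-! ## Bit masks -/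

theorem testBit_band {m a b i : ℕ} :
    (band m a b).testBit i ↔ i < m ∧ a.testBit i ∧ b.testBit i := by
  simp [band, Nat.testBit_mod_two_pow]

/-- A conjunction never exceeds its argument, so the comparison forces equality. This is how the
machine tests inclusion of masks. -/
theorem le_band_iff {m a b : ℕ} :
    a ≤ band m a b ↔ ∀ i, a.testBit i → i < m ∧ b.testBit i := by
  constructor
  · intro h i hi
    have heq : band m a b = a := le_antisymm (band_le_left _ _ _) h
    rw [← heq, testBit_band] at hi
    exact ⟨hi.1, hi.2.2⟩
  · intro h
    refine le_of_eq (Nat.eq_of_testBit_eq fun i => ?_)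
    rw [Bool.eq_iff_iff, testBit_band]
    exact ⟨fun hi => ⟨(h i hi).1, hi, (h i hi).2⟩, fun hi => hi.2.1⟩

theorem band_pos_iff {m a b : ℕ} :
    0 < band m a b ↔ ∃ i, i < m ∧ a.testBit i ∧ b.testBit i := by
  constructor
  · intro h
    obtain ⟨i, hi⟩ := Nat.exists_testBit_of_ne_zero h.ne'
    exact ⟨i, testBit_band.1 hi⟩
  · rintro ⟨i, hi⟩
    refine Nat.pos_of_ne_zero fun h0 => ?_
    have := testBit_band.2 hi
    simp [h0] at this

theorem testBit_sum_two_pow (s : Finset ℕ) (i : ℕ) :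
    (∑ j ∈ s, 2 ^ j).testBit i ↔ i ∈ s := by
  rw [← Nat.mem_bitIndices, ← List.mem_toFinset, Finset.toFinset_bitIndices_sum_two_pow]

/-- Subtracting a submask causes no borrows, so the machine computes set differences by ordinary
subtraction. -/
theorem testBit_sub {Y Q : ℕ} (h : ∀ i, Q.testBit i → Y.testBit i) (i : ℕ) :
    (Y - Q).testBit i ↔ Y.testBit i ∧ ¬ Q.testBit i := by
  have hsub : Q.bitIndices.toFinset ⊆ Y.bitIndices.toFinset := fun i hi => by
    simp only [List.mem_toFinset, Nat.mem_bitIndices] at hi ⊢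
    exact h i hi
  have hs := Finset.sum_sdiff (f := fun i => 2 ^ i) hsub
  rw [Finset.sum_toFinset_bitIndices_two_pow, Finset.sum_toFinset_bitIndices_two_pow] at hs
  rw [← Nat.eq_sub_of_add_eq hs, testBit_sum_two_pow]
  simp

/-! ### Vertex sets as masks -/

/-- The codes of a vertex cover and of neighbourhoods. -/
structure CoverCode {n : ℕ} (G : SimpleGraph (Fin n)) (pw nb : ℕ → ℕ) (m : ℕ) : Prop where
  pow : ∀ v, pw v ≠ 0 → ∃ i < m, pw v = 2 ^ i
  inj : ∀ u v, pw u ≠ 0 → pw u = pw v → u = v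
  cover : ∀ u v : Fin n, G.Adj u v → pw u ≠ 0 ∨ pw v ≠ 0
  nbhd : ∀ v : Fin n, ∀ i, (nb v).testBit i ↔ ∃ u : Fin n, (u = v ∨ G.Adj v u) ∧ pw u = 2 ^ i

/-- The vertex `v` belongs to the set with mask `Z`. -/
def InMask (pw : ℕ → ℕ) (Z v : ℕ) : Prop := ∃ i, pw v = 2 ^ i ∧ Z.testBit i

theorem inMask_iff {pw : ℕ → ℕ} {Z v i : ℕ} (h : pw v = 2 ^ i) : InMask pw Z v ↔ Z.testBit i := by
  constructor
  · rintro ⟨j, hj, hZ⟩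
    rwa [Nat.pow_right_injective le_rfl (h.symm.trans hj)]
  · exact fun hZ => ⟨i, h, hZ⟩

namespace CoverCode

variable {n m : ℕ} {G : SimpleGraph (Fin n)} {pw nb : ℕ → ℕ}

theorem lt (h : CoverCode G pw nb m) {v i : ℕ} (hv : pw v = 2 ^ i) : i < m := by
  obtain ⟨j, hj, hvj⟩ := h.pow v (by rw [hv]; positivity)
  rwa [Nat.pow_right_injective le_rfl (hv.symm.trans hvj)]

/-- A vertex outside the cover has code `0` and passes the test automatically. -/
theorem kept_iff (h : CoverCode G pw nb m) {Z v : ℕ} :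
    Kept m pw Z v ↔ (pw v ≠ 0 → InMask pw Z v) := by
  rw [Kept, le_band_iff]
  constructor
  · intro hk hv
    obtain ⟨i, hi, hvi⟩ := h.pow v hv
    exact ⟨i, hvi, (hk i (by rw [hvi, Nat.testBit_two_pow_self])).2⟩
  · intro hk i hi
    have hv : pw v ≠ 0 := by rintro h0; simp [h0] at hi
    obtain ⟨j, hj, hZ⟩ := hk hv
    rw [hj, Nat.testBit_two_pow, decide_eq_true_eq] at hi
    exact hi ▸ ⟨h.lt hj, hZ⟩

theorem pos_iff (h : CoverCode G pw nb m) {Z : ℕ} {v : Fin n} :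
    0 < band m (nb v) Z ↔ ∃ u : Fin n, (u = v ∨ G.Adj v u) ∧ InMask pw Z u := by
  rw [band_pos_iff]
  constructor
  · rintro ⟨i, -, hi, hZ⟩
    obtain ⟨u, hu, hui⟩ := (h.nbhd v i).1 hi
    exact ⟨u, hu, i, hui, hZ⟩
  · rintro ⟨u, hu, i, hui, hZ⟩
    exact ⟨i, h.lt hui, (h.nbhd v i).2 ⟨u, hu, hui⟩, hZ⟩

theorem subset_iff (h : CoverCode G pw nb m) {Z X : ℕ} {v : Fin n} :
    band m (nb v) Z ≤ band m (band m (nb v) Z) X ↔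
      ∀ u : Fin n, (u = v ∨ G.Adj v u) → InMask pw Z u → InMask pw X u := by
  rw [le_band_iff]
  constructor
  · rintro hs u hu ⟨i, hui, hZ⟩
    exact ⟨i, hui, (hs i (testBit_band.2 ⟨h.lt hui, (h.nbhd v i).2 ⟨u, hu, hui⟩, hZ⟩)).2⟩
  · intro hs i hi
    obtain ⟨him, hi, hZ⟩ := testBit_band.1 hi
    obtain ⟨u, hu, hui⟩ := (h.nbhd v i).1 hi
    exact ⟨him, (inMask_iff hui).1 (hs u hu ⟨i, hui, hZ⟩)⟩

end CoverCode

/-- The mask of a set of vertices. -/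
def mask {n : ℕ} (pw : ℕ → ℕ) (A : Finset (Fin n)) : ℕ := ∑ v ∈ A, pw v

/-- Different vertices with nonzero code contribute different powers of two, so the sum has no
carries; the other vertices contribute `0`. -/
theorem testBit_mask {n m : ℕ} {pw : ℕ → ℕ} (hpow : ∀ v, pw v ≠ 0 → ∃ i < m, pw v = 2 ^ i)
    (hinj : ∀ u v, pw u ≠ 0 → pw u = pw v → u = v) (A : Finset (Fin n)) (i : ℕ) :
    (mask pw A).testBit i ↔ ∃ u ∈ A, pw u = 2 ^ i := by
  classical
  have hidx : ∀ v : ℕ, ∃ j, pw v ≠ 0 → pw v = 2 ^ j := fun v => by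
    by_cases hv : pw v = 0
    · exact ⟨0, fun h => absurd hv h⟩
    · obtain ⟨j, -, hj⟩ := hpow v hv
      exact ⟨j, fun _ => hj⟩
  choose idx hidx using hidx
  have hm : mask pw A =
      ∑ j ∈ (A.filter fun v : Fin n => pw v ≠ 0).image fun v : Fin n => idx v, 2 ^ j := by
    rw [Finset.sum_image, mask, ← Finset.sum_filter_ne_zero]
    · exact Finset.sum_congr rfl fun v hv => hidx v (Finset.mem_filter.1 hv).2
    · intro u hu v hv huv
      have hu0 := (Finset.mem_filter.1 hu).2
      have hv0 := (Finset.mem_filter.1 hv).2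
      exact Fin.ext (hinj u v hu0 (by rw [hidx u hu0, hidx v hv0]; exact congrArg _ huv))
  rw [hm, testBit_sum_two_pow]
  simp only [Finset.mem_image, Finset.mem_filter]
  constructor
  · rintro ⟨u, ⟨hu, h0⟩, rfl⟩
    exact ⟨u, hu, hidx u h0⟩
  · rintro ⟨u, hu, hui⟩
    have h0 : pw u ≠ 0 := by rw [hui]; positivity
    exact ⟨u, ⟨hu, h0⟩, Nat.pow_right_injective le_rfl ((hidx u h0).symm.trans hui)⟩

end WVI

namespace WVI

/-! ## Correctness of the algorithm -/

section Correctness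

variable {n m : ℕ} {G : SimpleGraph (Fin n)} {w : Fin n → ℕ+} {w' pw nb : ℕ → ℕ}

/-- The vertices that `gain` counts for the sets `Z` and `X`. -/
def Counted (G : SimpleGraph (Fin n)) (pw : ℕ → ℕ) (Z X : ℕ) (v : Fin n) : Prop :=
  (pw v ≠ 0 → InMask pw Z v) ∧ (∃ u : Fin n, (u = v ∨ G.Adj v u) ∧ InMask pw Z u) ∧
    ∀ u : Fin n, (u = v ∨ G.Adj v u) → InMask pw Z u → InMask pw X u

/-- The vertices that `isoWeight` counts for the set `Z`. -/
def Isolated (G : SimpleGraph (Fin n)) (pw : ℕ → ℕ) (Z : ℕ) (v : Fin n) : Prop :=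
  (pw v ≠ 0 → InMask pw Z v) ∧ ¬ ∃ u : Fin n, (u = v ∨ G.Adj v u) ∧ InMask pw Z u

open Classical in
theorem gain_eq (h : CoverCode G pw nb m) (hw : ∀ v : Fin n, w' v = w v) (Z X : ℕ) :
    gain n m w' pw nb Z X = weight w (Finset.univ.filter fun v => Counted G pw Z X v) := by
  rw [gain, Finset.sum_range, weight, Finset.sum_filter]
  refine Finset.sum_congr rfl fun v _ => ?_
  rw [hw v]
  exact if_congr (by rw [h.kept_iff, h.pos_iff, h.subset_iff, Counted]) rfl rfl

open Classical in
theorem isoWeight_eq (h : CoverCode G pw nb m) (hw : ∀ v : Fin n, w' v = w v) (Z : ℕ) :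
    isoWeight n m w' pw nb Z = weight w (Finset.univ.filter fun v => Isolated G pw Z v) := by
  rw [isoWeight, Finset.sum_range, weight, Finset.sum_filter]
  refine Finset.sum_congr rfl fun v _ => ?_
  rw [hw v]
  exact if_congr (by rw [h.kept_iff, h.pos_iff, Isolated]) rfl rfl

theorem isoMax_le_iff (h : CoverCode G pw nb m) (hw : ∀ v : Fin n, w' v = w v) (Z L : ℕ) :
    isoMax n m w' pw nb Z ≤ L ↔ ∀ v : Fin n, Isolated G pw Z v → (w v : ℕ) ≤ L := by
  rw [isoMax, Finset.sup_le_iff]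
  have key : ∀ v : Fin n, Kept m pw Z v ∧ ¬ 0 < band m (nb v) Z ↔ Isolated G pw Z v := fun v => by
    rw [h.kept_iff, h.pos_iff, Isolated]
  constructor
  · intro hle v hv
    have := hle v (Finset.mem_range.2 v.2)
    rwa [if_pos ((key v).2 hv), hw] at this
  · intro hle v hv
    split_ifs with hc
    · have := hle ⟨v, Finset.mem_range.1 hv⟩ ((key ⟨v, Finset.mem_range.1 hv⟩).1 hc)
      rwa [← hw] at this
    · exact Nat.zero_le _

theorem inMask_sub {Y Q : ℕ} (hQ : ∀ i, Q.testBit i → Y.testBit i) (v : ℕ) :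
    InMask pw (Y - Q) v ↔ InMask pw Y v ∧ ¬ InMask pw Q v := by
  constructor
  · rintro ⟨i, hi, hb⟩
    rw [testBit_sub hQ] at hb
    exact ⟨⟨i, hi, hb.1⟩, fun h => hb.2 ((inMask_iff hi).1 h)⟩
  · rintro ⟨⟨i, hi, hb⟩, hn⟩
    exact ⟨i, hi, (testBit_sub hQ i).2 ⟨hb, fun h => hn ⟨i, hi, h⟩⟩⟩

/-- A packing yields a set of vertices with a labelling. -/
theorem Pack.exists_labelling (h : CoverCode G pw nb m) (hw : ∀ v : Fin n, w' v = w v)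
    {Z l Y s : ℕ} (hp : Pack m (gain n m w' pw nb Z) l Y s) :
    ∃ (T : Finset (Fin n)) (c : Fin n → ℕ), (∀ v ∈ T, Counted G pw Z Y v) ∧ weight w T = s ∧
      (∀ u ∈ T, ∀ v ∈ T, G.Adj u v → c u = c v) ∧
      ∀ a, weight w (T.filter fun v => c v = a) ≤ l := by
  classical
  induction hp with
  | nil Y => exact ⟨∅, fun _ => 0, by simp, by simp [weight], by simp, by simp [weight]⟩
  | @cons Y Q s h0 hb hl _ ih =>
    obtain ⟨T, c, hT, hs, hadj, hc⟩ := ih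
    have hQ : ∀ i, Q.testBit i → Y.testBit i := fun i hi => (le_band_iff.1 hb i hi).2
    have hQY : ∀ v, InMask pw Q v → InMask pw Y v := fun v ⟨i, hi, hv⟩ => ⟨i, hi, hQ i hv⟩
    rw [gain_eq h hw] at hl ⊢
    set U := Finset.univ.filter fun v => Counted G pw Z Q v with hU
    have hUmem : ∀ v, v ∈ U ↔ Counted G pw Z Q v := by simp [hU]
    -- A common vertex of the two closed neighbourhoods in `Z` would lie both in `Q` and in `Y - Q`.
    -- If `u = v`, its nonempty neighbourhood in `Z` supplies one. If `u` and `v` are adjacent, an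
    -- end of the edge belongs to the cover, hence to `Z`, and is common to both.
    have hdisj : ∀ u ∈ T, ∀ v ∈ U, u ≠ v ∧ ¬ G.Adj u v := by
      intro u hu v hv
      have hu' := hT u hu
      have hv' := (hUmem v).1 hv
      have hcontra : ∀ x : Fin n, (x = u ∨ G.Adj u x) → (x = v ∨ G.Adj v x) →
          ¬ InMask pw Z x := by
        intro x hxu hxv hx
        exact ((inMask_sub hQ _).1 (hu'.2.2 x hxu hx)).2 (hv'.2.2 x hxv hx)
      constructor
      · rintro rfl
        obtain ⟨x, hx, hxZ⟩ := hu'.2.1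
        exact hcontra x hx hx hxZ
      · intro huv
        rcases h.cover u v huv with hc | hc
        · exact hcontra u (.inl rfl) (.inr huv.symm) (hu'.1 hc)
        · exact hcontra v (.inr huv) (.inl rfl) (hv'.1 hc)
    -- The new part gets label `0` and the old labels are shifted by one.
    have hTU : Disjoint U T := Finset.disjoint_left.2 fun v hv hv' => (hdisj v hv' v hv).1 rfl
    refine ⟨U ∪ T, fun v => if v ∈ T then c v + 1 else 0, ?_, ?_, ?_, ?_⟩
    · intro v hv
      rcases Finset.mem_union.1 hv with hv | hv
      · have hv' := (hUmem v).1 hv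
        exact ⟨hv'.1, hv'.2.1, fun u hu hZ => hQY _ (hv'.2.2 u hu hZ)⟩
      · have hv' := hT v hv
        exact ⟨hv'.1, hv'.2.1, fun u hu hZ => ((inMask_sub hQ _).1 (hv'.2.2 u hu hZ)).1⟩
    · rw [weight, Finset.sum_union hTU, ← hs]; rfl
    · intro u hu v hv huv
      rcases Finset.mem_union.1 hu with hu | hu <;> rcases Finset.mem_union.1 hv with hv | hv
      · simp [Finset.disjoint_left.1 hTU hu, Finset.disjoint_left.1 hTU hv]
      · exact absurd huv.symm (hdisj v hv u hu).2
      · exact absurd huv (hdisj u hu v hv).2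
      · simp [hu, hv, hadj u hu v hv huv]
    · intro a
      rcases Nat.eq_zero_or_pos a with rfl | ha
      · refine (weight_mono w fun v hv => ?_).trans hl
        simp only [Finset.mem_filter, Finset.mem_union] at hv
        by_contra hvU
        have hvT : v ∈ T := hv.1.resolve_left hvU
        simp [hvT] at hv
      · refine (weight_mono w fun v hv => ?_).trans (hc (a - 1))
        simp only [Finset.mem_filter, Finset.mem_union] at hv ⊢
        have hvT : v ∈ T := by
          by_contra hvT
          have := hv.2
          simp [hvT] at this
          omega
        refine ⟨hvT, ?_⟩
        have := hv.2
        simp only [hvT, if_true] at this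
        omega

/-- A packing need not exhaust `Z`. Whatever it does not account for is deleted, except the vertices
without neighbours in `Z`, which are kept as well. -/
theorem wvi_le_of_accept (h : CoverCode G pw nb m) (hw : ∀ v : Fin n, w' v = w v) {k : ℕ}
    (ha : Accept n m k w' pw nb) : wvi G w ≤ k := by
  classical
  obtain ⟨Z, -, X, -, s, hp, hk⟩ := ha
  set l := gain n m w' pw nb Z X
  obtain ⟨T, c, hT, hs, hadj, hc⟩ := hp.exists_labelling h hw
  set I := Finset.univ.filter fun v => Isolated G pw Z v with hI
  have hImem : ∀ v, v ∈ I ↔ Isolated G pw Z v := by simp [hI]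
  have hdisj : Disjoint T I := Finset.disjoint_left.2 fun v hv hvI =>
    ((hImem v).1 hvI).2 (hT v hv).2.1
  have hiso : ∀ u ∈ I, ∀ v, v ∉ (T ∪ I)ᶜ → ¬ G.Adj u v := by
    intro u hu v hv huv
    have hu' := (hImem u).1 hu
    rw [Finset.mem_compl, not_not, Finset.mem_union] at hv
    have hvk : pw v ≠ 0 → InMask pw Z v := by
      rcases hv with hv | hv
      exacts [(hT v hv).1, ((hImem v).1 hv).1]
    rcases h.cover u v huv with h0 | h0
    · exact hu'.2 ⟨u, .inl rfl, hu'.1 h0⟩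
    · exact hu'.2 ⟨v, .inr huv, hvk h0⟩
  -- Even labels serve the packed vertices; odd labels give each isolated vertex a class of its own.
  refine (wvi_le_iff G w k).2 ⟨(T ∪ I)ᶜ, fun v => if v ∈ T then 2 * c v else 2 * v + 1,
    max l (isoMax n m w' pw nb Z), ⟨?_, ?_⟩, ?_⟩
  · intro u v hu hv huv
    have hu' := hu
    have hv' := hv
    rw [Finset.mem_compl, not_not, Finset.mem_union] at hu' hv'
    rcases hu' with hu' | hu'
    · rcases hv' with hv' | hv'
      · simp [hu', hv', hadj u hu' v hv' huv]
      · exact absurd huv.symm (hiso v hv' u hu)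
    · exact absurd huv (hiso u hu' v hv)
  · intro a
    rcases Nat.even_or_odd' a with ⟨b, rfl | rfl⟩
    · refine le_max_of_le_left ((weight_mono w fun v hv => ?_).trans (hc b))
      simp only [Finset.mem_filter, Finset.mem_univ, true_and] at hv ⊢
      have hv2 := hv.2
      split_ifs at hv2 with hvT
      · exact ⟨hvT, by omega⟩
      · omega
    · refine le_max_of_le_right ?_
      rcases Finset.eq_empty_or_nonempty (Finset.univ.filter fun v => v ∉ (T ∪ I)ᶜ ∧
        (if v ∈ T then 2 * c v else 2 * (v : ℕ) + 1) = 2 * b + 1) with he | ⟨x, hx⟩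
      · rw [he]; simp [weight]
      · have key : ∀ v, v ∈ (Finset.univ.filter fun v => v ∉ (T ∪ I)ᶜ ∧
            (if v ∈ T then 2 * c v else 2 * (v : ℕ) + 1) = 2 * b + 1) →
            v ∈ I ∧ (v : ℕ) = b := by
          intro v hv
          simp only [Finset.mem_filter, Finset.mem_univ, true_and] at hv
          have hv2 := hv.2
          have hv1 := hv.1
          rw [Finset.mem_compl, not_not, Finset.mem_union] at hv1
          split_ifs at hv2 with hvT
          · omega
          · exact ⟨hv1.resolve_left hvT, by omega⟩
        refine (weight_mono w (T := {x}) fun v hv => ?_).trans ?_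
        · exact Finset.mem_singleton.2 (Fin.ext ((key v hv).2.trans (key x hx).2.symm))
        · rw [weight, Finset.sum_singleton]
          exact (isoMax_le_iff h hw Z _).1 le_rfl x ((hImem x).1 (key x hx).1)
  · rw [isoWeight_eq h hw] at hk
    have h1 : weight w (T ∪ I) + weight w (T ∪ I)ᶜ = ∑ v, (w v : ℕ) :=
      Finset.sum_add_sum_compl _ _
    have h2 : weight w (T ∪ I) = weight w T + weight w I := Finset.sum_union hdisj
    rw [Finset.sum_range, Finset.sum_congr rfl fun v _ => hw v] at hk
    change _ ≤ k + s + weight w I at hk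
    omega

/-- The witnesses come from an irredundant solution: `Z` is the remaining part of the cover, its
label classes are the packing, and `X` is the class of largest gain. -/
theorem accept_of_wvi_le (h : CoverCode G pw nb m) (hw : ∀ v : Fin n, w' v = w v) {k : ℕ}
    (hk : wvi G w ≤ k) : Accept n m k w' pw nb := by
  classical
  obtain ⟨S, c, L, hL, hkL, hirr⟩ := exists_irredundant hk
  set C := Finset.univ.filter fun v : Fin n => pw v ≠ 0 ∧ v ∉ S with hC
  have hCmem : ∀ v, v ∈ C ↔ pw v ≠ 0 ∧ v ∉ S := by simp [hC]
  have hmask : ∀ (A : Finset (Fin n)) (v : Fin n), InMask pw (mask pw A) v ↔ v ∈ A ∧ pw v ≠ 0 := by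
    intro A v
    constructor
    · rintro ⟨i, hi, hb⟩
      obtain ⟨u, hu, hui⟩ := (testBit_mask h.pow h.inj A i).1 hb
      have h0 : pw u ≠ 0 := by rw [hui]; positivity
      obtain rfl : u = v := Fin.ext (h.inj u v h0 (hui.trans hi.symm))
      exact ⟨hu, h0⟩
    · rintro ⟨hv, h0⟩
      obtain ⟨i, -, hi⟩ := h.pow v h0
      exact ⟨i, hi, (testBit_mask h.pow h.inj A i).2 ⟨v, hv, hi⟩⟩
  have hmlt : ∀ A : Finset (Fin n), mask pw A < 2 ^ m := by
    intro A
    refine Nat.lt_pow_two_of_testBit _ fun i hi => ?_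
    rw [← Bool.not_eq_true, testBit_mask h.pow h.inj]
    rintro ⟨u, -, hu⟩
    exact absurd (h.lt hu) (by omega)
  have hsubbit : ∀ {A B : Finset (Fin n)}, A ⊆ B → ∀ i, (mask pw A).testBit i →
      (mask pw B).testBit i := by
    intro A B hAB i hi
    obtain ⟨u, hu, hui⟩ := (testBit_mask h.pow h.inj A i).1 hi
    exact (testBit_mask h.pow h.inj B i).2 ⟨u, hAB hu, hui⟩
  set Z := mask pw C with hZ
  have hZmem : ∀ v : Fin n, InMask pw Z v ↔ v ∈ C := fun v => by
    rw [hmask]; exact ⟨fun hv => hv.1, fun hv => ⟨hv, ((hCmem v).1 hv).1⟩⟩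
  -- a vertex outside the cover has all its remaining neighbours in `Z`
  have hkept : ∀ v : Fin n, v ∉ S → pw v ≠ 0 → InMask pw Z v := fun v hv h0 =>
    (hZmem v).2 ((hCmem v).2 ⟨h0, hv⟩)
  -- A deleted vertex that passes the test `Kept` is outside the cover. The two differently labelled
  -- neighbours given by irredundance then belong to the cover.
  have hdel : ∀ v ∈ S, (pw v ≠ 0 → InMask pw Z v) → ∃ x y : Fin n, G.Adj v x ∧ G.Adj v y ∧
      x ∈ C ∧ y ∈ C ∧ c x ≠ c y := by
    intro v hv hvk
    have h0 : pw v = 0 := by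
      by_contra h0
      exact ((hCmem v).1 ((hZmem v).1 (hvk h0))).2 hv
    obtain ⟨x, y, hx, hy, hvx, hvy, hxy⟩ := hirr v hv
    have hcov : ∀ z, G.Adj v z → pw z ≠ 0 := fun z hz =>
      (h.cover v z hz).resolve_left (by simp [h0])
    exact ⟨x, y, hvx, hvy, (hCmem x).2 ⟨hcov x hvx, hx⟩, (hCmem y).2 ⟨hcov y hvy, hy⟩, hxy⟩
  have hsame : ∀ u v : Fin n, u ∉ S → v ∉ S → (u = v ∨ G.Adj v u) → c u = c v := by
    rintro u v hu hv (rfl | huv)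
    · rfl
    · exact hL.adj u v hu hv huv.symm
  -- the vertices that are counted for the part with label `a`
  have hcount : ∀ a v, Counted G pw Z (mask pw (C.filter fun u => c u = a)) v ↔
      v ∉ S ∧ (∃ u : Fin n, (u = v ∨ G.Adj v u) ∧ u ∈ C) ∧ c v = a := by
    intro a v
    simp only [Counted, hZmem, hmask, Finset.mem_filter]
    constructor
    · rintro ⟨hvk, ⟨u, huv, hu⟩, hsub⟩
      have hvS : v ∉ S := by
        -- Were `v` deleted, its differently labelled neighbours would both have label `a`.
        intro hvS
        obtain ⟨x, y, hvx, hvy, hx, hy, hxy⟩ := hdel v hvS (by rwa [hZmem])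
        exact hxy ((hsub x (.inr hvx) hx).1.2.trans (hsub y (.inr hvy) hy).1.2.symm)
      refine ⟨hvS, ⟨u, huv, hu⟩, ?_⟩
      rw [← hsame u v ((hCmem u).1 hu).2 hvS huv]
      exact (hsub u huv hu).1.2
    · rintro ⟨hvS, ⟨u, huv, hu⟩, rfl⟩
      refine ⟨fun h0 => (hCmem v).2 ⟨h0, hvS⟩, ⟨u, huv, hu⟩, fun x hx hxC => ?_⟩
      have hx' := (hCmem x).1 hxC
      exact ⟨⟨hxC, hsame x v hx'.2 hvS hx⟩, hx'.1⟩
  have hisoS : ∀ v, Isolated G pw Z v ↔ v ∉ S ∧ ¬ ∃ u : Fin n, (u = v ∨ G.Adj v u) ∧ u ∈ C := by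
    intro v
    simp only [Isolated, hZmem]
    constructor
    · rintro ⟨hvk, hn⟩
      refine ⟨fun hvS => ?_, hn⟩
      obtain ⟨x, y, hvx, hvy, hx, hy, hxy⟩ := hdel v hvS (by rwa [hZmem])
      exact hn ⟨x, .inr hvx, hx⟩
    · rintro ⟨hvS, hn⟩
      exact ⟨fun h0 => (hCmem v).2 ⟨h0, hvS⟩, hn⟩
  set g := gain n m w' pw nb Z with hg
  set Q : ℕ → ℕ := fun a => mask pw (C.filter fun u => c u = a) with hQ
  have hgQ : ∀ a, g (Q a) = weight w (Finset.univ.filter fun v =>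
      v ∉ S ∧ (∃ u : Fin n, (u = v ∨ G.Adj v u) ∧ u ∈ C) ∧ c v = a) := fun a => by
    rw [hg, gain_eq h hw]
    congr 1
    ext v
    simp only [Finset.mem_filter, Finset.mem_univ, true_and]
    exact hcount a v
  have hgL : ∀ a, g (Q a) ≤ L := fun a => by
    rw [hgQ]
    refine (weight_mono w fun v hv => ?_).trans (hL.le a)
    simp only [Finset.mem_filter, Finset.mem_univ, true_and] at hv ⊢
    exact ⟨hv.1, hv.2.2⟩
  -- If there are no classes, `X = 0` serves, with gain `0`.
  obtain ⟨X, hXlt, hXL, hXmax⟩ : ∃ X < 2 ^ m, g X ≤ L ∧ ∀ a ∈ C.image c, g (Q a) ≤ g X := by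
    rcases (C.image c).eq_empty_or_nonempty with he | hne
    · refine ⟨0, by positivity, ?_, by simp [he]⟩
      rw [hg, gain_zero]; exact Nat.zero_le _
    · obtain ⟨a, -, hmax⟩ := Finset.exists_max_image _ (fun a => g (Q a)) hne
      exact ⟨Q a, hmlt _, hgL a, hmax⟩
  -- The classes are peeled off one label at a time.
  have hpack : ∀ A ⊆ C.image c, Pack m g (g X) (mask pw (C.filter fun u => c u ∈ A))
      (∑ a ∈ A, g (Q a)) := by
    intro A
    induction A using Finset.induction_on with
    | empty => exact fun _ => by simpa using Pack.nil _
    | @insert a A haA ih =>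
      intro hA
      rw [Finset.sum_insert haA]
      obtain ⟨haC, hAC⟩ := Finset.insert_subset_iff.1 hA
      have hsub : (C.filter fun u => c u = a) ⊆ C.filter fun u => c u ∈ insert a A := by
        intro u hu
        simp only [Finset.mem_filter, Finset.mem_insert] at hu ⊢
        exact ⟨hu.1, .inl hu.2⟩
      have hdiff : mask pw (C.filter fun u => c u ∈ insert a A) - Q a =
          mask pw (C.filter fun u => c u ∈ A) := by
        have hs : mask pw (C.filter fun u => c u ∈ insert a A) =
            Q a + mask pw (C.filter fun u => c u ∈ A) := by
          simp only [hQ, mask]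
          rw [← Finset.sum_union]
          · refine Finset.sum_congr ?_ fun _ _ => rfl
            ext u
            simp only [Finset.mem_filter, Finset.mem_insert, Finset.mem_union]
            tauto
          · refine Finset.disjoint_left.2 fun u hu hu' => ?_
            simp only [Finset.mem_filter] at hu hu'
            exact haA (hu.2 ▸ hu'.2)
        omega
      refine .cons ?_ (le_band_iff.2 fun i hi => ⟨?_, hsubbit hsub i hi⟩) (hXmax a haC) ?_
      · obtain ⟨u, hu, rfl⟩ := Finset.mem_image.1 haC
        refine Nat.pos_of_ne_zero fun h0 => ?_
        obtain ⟨i, -, hi⟩ := h.pow u ((hCmem u).1 hu).1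
        have := (testBit_mask h.pow h.inj (C.filter fun x => c x = c u) i).2 ⟨u, by simp [hu], hi⟩
        change (Q (c u)).testBit i = true at this
        simp [h0] at this
      · obtain ⟨u, -, hu⟩ := (testBit_mask h.pow h.inj _ i).1 hi
        exact h.lt hu
      · rw [hdiff]
        exact ih hAC
  have hCself : (C.filter fun u => c u ∈ C.image c) = C :=
    Finset.filter_true_of_mem fun u hu => Finset.mem_image_of_mem c hu
  have hpackZ := hpack _ subset_rfl
  rw [hCself] at hpackZ
  refine ⟨Z, hmlt _, X, hXlt, _, hpackZ, ?_⟩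
  have hmax : max (g X) (isoMax n m w' pw nb Z) ≤ L := by
    refine max_le hXL ((isoMax_le_iff h hw Z L).2 fun v hv => ?_)
    refine le_trans ?_ (hL.le (c v))
    have : weight w {v} ≤ weight w (Finset.univ.filter fun x => x ∉ S ∧ c x = c v) :=
      weight_mono w (by simpa using ((hisoS v).1 hv).1)
    simpa [weight] using this
  have hsum : ∑ a ∈ C.image c, g (Q a) = weight w (Finset.univ.filter fun v =>
      v ∉ S ∧ ∃ u : Fin n, (u = v ∨ G.Adj v u) ∧ u ∈ C) := by
    rw [weight, ← Finset.sum_fiberwise_of_maps_to (g := c) (t := C.image c)]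
    · refine Finset.sum_congr rfl fun a _ => ?_
      rw [hgQ, weight, Finset.filter_filter]
      refine Finset.sum_congr ?_ fun _ _ => rfl
      ext v
      simp only [Finset.mem_filter, Finset.mem_univ, true_and, and_assoc]
    · intro v hv
      simp only [Finset.mem_filter, Finset.mem_univ, true_and] at hv
      obtain ⟨hvS, u, huv, hu⟩ := hv
      rw [← hsame u v ((hCmem u).1 hu).2 hvS huv]
      exact Finset.mem_image_of_mem c hu
  have hiso : isoWeight n m w' pw nb Z = weight w (Finset.univ.filter fun v =>
      v ∉ S ∧ ¬ ∃ u : Fin n, (u = v ∨ G.Adj v u) ∧ u ∈ C) := by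
    rw [isoWeight_eq h hw]
    congr 1
    ext v
    simp only [Finset.mem_filter, Finset.mem_univ, true_and]
    exact hisoS v
  -- The vertices split into the deleted ones, those with a closed neighbour in `C`, and the
  -- isolated ones. Together with `hmax` and `w(S) + L ≤ k` this is the accepting inequality.
  have htot : ∑ v ∈ Finset.range n, w' v =
      weight w S + (∑ a ∈ C.image c, g (Q a) + isoWeight n m w' pw nb Z) := by
    rw [Finset.sum_range, Finset.sum_congr rfl fun v _ => hw v, hsum, hiso, weight, weight, weight,
      ← Finset.sum_add_sum_compl S]
    congr 1
    rw [← Finset.filter_filter, ← Finset.filter_filter, Finset.sum_filter_add_sum_filter_not]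
    refine Finset.sum_congr ?_ fun _ _ => rfl
    ext v; simp
  change _ + max (g X) _ ≤ _
  omega

theorem accept_iff (h : CoverCode G pw nb m) (hw : ∀ v : Fin n, w' v = w v) (k : ℕ) :
    Accept n m k w' pw nb ↔ wvi G w ≤ k :=
  ⟨wvi_le_of_accept h hw, accept_of_wvi_le h hw⟩

end Correctness

end WVI

namespace WVI

open RAM

/-! ## The machine -/

/-- The computation after the matching. -/
def solve : Cmd := .seq neighborTable tryKept

/-- Moves the answer to register `0`. -/
def answer : Cmd :=
  .ite (.reg 2) (.const 1) (.set 0 (.reg 8)) (.set 0 (.const 0))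

/-- The machine that decides Weighted Vertex Integrity. -/
def machine : Prog := .seq matching.compile (.seq solve.compile answer.compile)

theorem mul_add_inj {n i j i' j' : ℕ} (hj : j < n) (hj' : j' < n) (h : n * i + j = n * i' + j') :
    i = i' ∧ j = j' := by
  have hn : 0 < n := by omega
  have hi : i = i' := by
    have := congrArg (· / n) h
    simpa [Nat.mul_add_div hn, Nat.div_eq_of_lt hj, Nat.div_eq_of_lt hj'] using this
  subst hi
  exact ⟨rfl, by omega⟩

/-! ### The input and its size -/

namespace Instance

variable (I : Instance)

theorem input_arr_zero (v : Fin I.n) : I.input.arr 0 v = I.w v := by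
  simp [Instance.input]

theorem input_adj (i j : Fin I.n) : 0 < I.input.arr 1 (I.n * i + j) ↔ I.G.Adj i j := by
  have : (∃ i' j' : Fin I.n, I.G.Adj i' j' ∧ I.n * (i : ℕ) + j = I.n * i' + j') ↔ I.G.Adj i j := by
    constructor
    · rintro ⟨i', j', h, he⟩
      obtain ⟨h1, h2⟩ := mul_add_inj j.2 j'.2 he
      rwa [Fin.ext h1, Fin.ext h2]
    · exact fun h => ⟨i, j, h, rfl⟩
  simp only [Instance.input]
  simp only [one_ne_zero, if_false, if_true]
  split_ifs with h
  · simpa using this.1 h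
  · simpa using mt this.2 h

theorem adjOf_input (i j : ℕ) : adjOf I.input i j ↔
    ∃ (hi : i < I.n) (hj : j < I.n), I.G.Adj ⟨i, hi⟩ ⟨j, hj⟩ := by
  constructor
  · rintro ⟨hi, hj, h⟩
    exact ⟨hi, hj, (I.input_adj ⟨i, hi⟩ ⟨j, hj⟩).1 h⟩
  · rintro ⟨hi, hj, h⟩
    exact ⟨hi, hj, (I.input_adj ⟨i, hi⟩ ⟨j, hj⟩).2 h⟩

theorem n_le_size : I.n ≤ I.size := by
  have : I.n ≤ I.n ^ 2 := Nat.le_self_pow two_ne_zero _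
  unfold Instance.size
  omega

theorem size_pos : 0 < I.size := by
  have : 0 < len I.n := Nat.succ_pos _
  unfold Instance.size
  omega

theorem lt_two_pow_of_len_le {x b : ℕ} (h : len x ≤ b) : x < 2 ^ b :=
  Nat.size_le.1 ((Nat.le_succ _).trans h)

theorem input_below : I.input.Below I.size := by
  have h1 : (1 : ℕ) < 2 ^ I.size := Nat.one_lt_two_pow I.size_pos.ne'
  have h0 : (0 : ℕ) < 2 ^ I.size := by positivity
  constructor
  · intro r
    simp only [Instance.input]
    split_ifs
    · exact lt_two_pow_of_len_le (by unfold Instance.size; omega)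
    · exact lt_two_pow_of_len_le (by unfold Instance.size; omega)
    all_goals assumption
  · intro a i
    simp only [Instance.input]
    split_ifs with _ h
    · refine lt_two_pow_of_len_le ?_
      have : len (I.w ⟨i, h⟩) ≤ ∑ v, len (I.w v) :=
        Finset.single_le_sum (f := fun v => len (I.w v : ℕ)) (fun _ _ => Nat.zero_le _)
          (Finset.mem_univ _)
      unfold Instance.size
      omega
    all_goals assumption

/-- A minimum vertex cover is inserted in the matching bound. -/
theorem le_two_mul_vc {pw : ℕ → ℕ} {m : ℕ}
    (h : MatchingCode I.n (adjOf I.input) pw m) : m ≤ 2 * I.vc := by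
  classical
  obtain ⟨s, hs, hcov⟩ := I.G.vertexCoverNum_exists
  have hcard : s.toFinset.card = I.vc := by
    rw [Instance.vc, ← hs, Set.encard_eq_coe_toFinset_card, ENat.toNat_natCast]
  refine (h.le (s.toFinset.image fun v : Fin I.n => (v : ℕ)) ?_).trans ?_
  · intro u v huv
    obtain ⟨hu, hv, hadj⟩ := (I.adjOf_input u v).1 huv
    rcases hcov hadj with hx | hx
    · exact .inl (Finset.mem_image.2 ⟨⟨u, hu⟩, by simpa using hx, rfl⟩)
    · exact .inr (Finset.mem_image.2 ⟨⟨v, hv⟩, by simpa using hx, rfl⟩)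
  · rw [← hcard]
    exact Nat.mul_le_mul_left _ ((Finset.card_filter_le _ _).trans Finset.card_image_le)

theorem coverCode {pw nb : ℕ → ℕ} {m : ℕ} (h : MatchingCode I.n (adjOf I.input) pw m)
    (hcov : ∀ i j, adjOf I.input i j → pw i ≠ 0 ∨ pw j ≠ 0)
    (hnb : ∀ v < I.n, nb v = pw v + ∑ u ∈ Finset.range I.n,
      if 0 < I.input.arr 1 (I.n * v + u) then pw u else 0) : CoverCode I.G pw nb m := by
  classical
  refine ⟨h.pow, h.inj, fun u v huv => hcov u v ((I.adjOf_input _ _).2 ⟨u.2, v.2, huv⟩),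
    fun v i => ?_⟩
  have hm : nb v = mask pw (insert v (Finset.univ.filter fun u => I.G.Adj v u)) := by
    rw [hnb v v.2, mask, Finset.sum_insert (by simp), Finset.sum_range, Finset.sum_filter]
    congr 1
    exact Finset.sum_congr rfl fun u _ => if_congr (I.input_adj v u) rfl rfl
  rw [hm, testBit_mask h.pow h.inj]
  simp

theorem yes_iff : I.Yes ↔ ¬ I.k < 0 ∧ wvi I.G I.w ≤ I.k.natAbs := by
  unfold Instance.Yes
  omega

end Instance

/-! ### Running time of the machine -/

theorem machine_ev : ∃ K D, ∀ I : Instance,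
    Ev machine I.input (K * (2 ^ (2 * I.vc) * I.size) ^ D) fun σ =>
      (I.Yes → σ.reg 0 = 1) ∧ (¬ I.Yes → σ.reg 0 = 0) := by
  obtain ⟨K₁, D₁, h₁⟩ := matching.exists_cost_le
  obtain ⟨K₂, D₂, h₂⟩ := solve.exists_cost_le
  refine ⟨K₁ * 3 ^ D₁ + K₂ * 3 ^ D₂ + answer.cost 0, D₁ + D₂, fun I => ?_⟩
  have hirr : ∀ i, ¬ adjOf I.input i i := fun i hi => by
    obtain ⟨_, _, h⟩ := (I.adjOf_input i i).1 hi
    exact h.ne rfl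
  have hin0 : I.input.reg 0 = I.n := rfl
  obtain ⟨hP, hM, hcov⟩ := matching_den I.input (fun v => by simp [Instance.input])
    (by simp [Instance.input]) (by simp [Instance.input]) hirr
  have hF₁ := matching.frame I.input
  set σ₁ := matching.den I.input with hσ₁
  have r10 : σ₁.reg 0 = I.n := hF₁.1 0 (by decide)
  have r11 : σ₁.reg 1 = I.k.natAbs := hF₁.1 1 (by decide)
  have r12 : σ₁.reg 2 = if I.k < 0 then 1 else 0 := hF₁.1 2 (by decide)
  have a10 : σ₁.arr 0 = I.input.arr 0 := hF₁.2 0 (by decide)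
  have a11 : σ₁.arr 1 = I.input.arr 1 := hF₁.2 1 (by decide)
  obtain ⟨hnb, hW⟩ := neighborTable_den σ₁
  have hF₂ := neighborTable.frame σ₁
  set σ₂ := neighborTable.den σ₁ with hσ₂
  have r20 : σ₂.reg 0 = I.n := (hF₂.1 0 (by decide)).trans r10
  have r21 : σ₂.reg 1 = I.k.natAbs := (hF₂.1 1 (by decide)).trans r11
  have r22 := (hF₂.1 2 (by decide)).trans r12
  have r23 : σ₂.reg 3 = σ₁.reg 3 := hF₂.1 3 (by decide)
  have r25 : σ₂.reg 5 = σ₁.reg 5 := hF₂.1 5 (by decide)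
  have a20 : σ₂.arr 0 = σ₁.arr 0 := hF₂.2 0 (by decide)
  have a22 : σ₂.arr 2 = σ₁.arr 2 := hF₂.2 2 (by decide)
  obtain ⟨h8le, h8⟩ := tryKept_den σ₂ (by rw [r23, r25, hP]) (by rw [hW, r20, r10, a20])
  have hF₃ := tryKept.frame σ₂
  have r32 := (hF₃.1 2 (by decide)).trans r22
  rw [r10, a11] at hnb
  have hcode : CoverCode I.G (σ₁.arr 2) (σ₂.arr 3) (σ₁.reg 5) := I.coverCode hM hcov hnb
  rw [r20, r25, r21, a20, a22, a10, accept_iff hcode I.input_arr_zero] at h8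
  have hvc : σ₁.reg 5 ≤ 2 * I.vc := I.le_two_mul_vc hM
  have hpow : 2 ^ σ₁.reg 5 ≤ 2 ^ (2 * I.vc) := Nat.pow_le_pow_right two_pos hvc
  have hn := I.n_le_size
  have hs := I.size_pos
  have hx : 1 ≤ 2 ^ (2 * I.vc) := Nat.one_le_two_pow
  set x := 2 ^ (2 * I.vc) * I.size with hxdef
  have hxs : I.size ≤ x := Nat.le_mul_of_pos_left _ hx
  have hxp : 2 ^ (2 * I.vc) ≤ x := Nat.le_mul_of_pos_right _ hs
  -- The matching computes registers `3` and `5`, so only register `0` may bound its loops; for the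
  -- rest all three are fixed and may serve as bounds. This is why the machine is compiled in
  -- separate pieces.
  have hrun : Ev machine I.input (matching.cost I.n + (solve.cost (I.n + 2 ^ σ₁.reg 5) +
      answer.cost 0)) (Sim (answer.den (tryKept.den σ₂))) := by
    refine .seq ((Cmd.compile_ev (B := [0]) (by decide) (σ := I.input)
      (by simp [hin0]) ⟨fun _ _ => rfl, rfl⟩).mono le_rfl fun τ₁ hτ₁ => ?_)
    refine .seq ((Cmd.compile_ev (B := [0, 3, 5]) (by decide) (σ := σ₁) ?_ hτ₁).mono le_rfl
      fun τ₂ hτ₂ => ?_)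
    · have := (Nat.lt_two_pow_self (n := σ₁.reg 5)).le
      intro r hr
      simp only [List.mem_cons, List.not_mem_nil, or_false] at hr
      rcases hr with rfl | rfl | rfl <;> omega
    · exact Cmd.compile_ev (B := []) (by decide) (σ := solve.den σ₁) (by simp) hτ₂
  refine hrun.mono ?_ fun τ hτ => ?_
  · have e1 : matching.cost I.n ≤ K₁ * 3 ^ D₁ * x ^ (D₁ + D₂) := by
      refine (h₁ I.n).trans ?_
      rw [mul_assoc]
      refine Nat.mul_le_mul_left _ ?_
      calc (I.n + 1) ^ D₁ ≤ (3 * x) ^ D₁ := Nat.pow_le_pow_left (by omega) _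
        _ = 3 ^ D₁ * x ^ D₁ := mul_pow _ _ _
        _ ≤ 3 ^ D₁ * x ^ (D₁ + D₂) :=
          Nat.mul_le_mul_left _ (Nat.pow_le_pow_right (by omega) (by omega))
    have e2 : solve.cost (I.n + 2 ^ σ₁.reg 5) ≤ K₂ * 3 ^ D₂ * x ^ (D₁ + D₂) := by
      refine (h₂ _).trans ?_
      rw [mul_assoc]
      refine Nat.mul_le_mul_left _ ?_
      -- Each of `n`, `2 ^ m` and `1` is at most `x`; hence the factor `3`.
      calc (I.n + 2 ^ σ₁.reg 5 + 1) ^ D₂ ≤ (3 * x) ^ D₂ := Nat.pow_le_pow_left (by omega) _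
        _ = 3 ^ D₂ * x ^ D₂ := mul_pow _ _ _
        _ ≤ 3 ^ D₂ * x ^ (D₁ + D₂) :=
          Nat.mul_le_mul_left _ (Nat.pow_le_pow_right (by omega) (by omega))
    have e3 : answer.cost 0 ≤ answer.cost 0 * x ^ (D₁ + D₂) :=
      Nat.le_mul_of_pos_right _ (by have : 0 < x := by omega
                                    positivity)
    linarith
  · have hτ0 : τ.reg 0 = if I.k < 0 then 0 else (tryKept.den σ₂).reg 8 := by
      rw [hτ.1 0 (by omega)]
      have e : (Ex.reg 2).den (tryKept.den σ₂) < (Ex.const 1).den (tryKept.den σ₂) ↔ ¬ I.k < 0 := by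
        simp only [Ex.den, r32]
        split_ifs with hk <;> simp [hk]
      rw [answer, Cmd.den_ite]
      by_cases hk : I.k < 0
      · rw [if_neg (by rw [e]; simpa using hk), if_pos hk]
        simp [Cmd.den_set, Ex.den]
      · rw [if_pos (e.2 hk), if_neg hk]
        simp [Cmd.den_set, Ex.den]
    rw [hτ0, I.yes_iff]
    split_ifs with hk
    · simp [hk]
    · simp only [hk, not_false_eq_true, true_and]
      exact ⟨h8.2, fun h => by have := mt h8.1 h; omega⟩

end WVI

/-- Weighted Vertex Integrity can be solved in time `2^{O(vc)} · N^{O(1)}`, where `vc` is the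
vertex cover number of the graph and `N` is the size of the input, with weights in binary. -/
theorem mainTheorem5 :
    ∃ (p : RAM.Prog) (A c d : ℕ),
      RAM.DecidesInTime p WVI.Instance.input WVI.Instance.Yes
        (fun I => A * 2 ^ (c * I.vc) * I.size ^ d) := by
  obtain ⟨K, D, h⟩ := WVI.machine_ev
  set B := WVI.machine.maxConst with hB
  -- With `s ≤ K * x ^ D` unit steps and numbers initially below `2 ^ (size + B)`, the cost is at
  -- most `s * (2 * (size + B + s) + 2)`. The second factor is at most `(2 * K + 2 * B + 4) * x ^ (D
  -- + 1)`; the exponent `D + 1` also covers `D = 0`. Expanding `x ^ (2 * D + 1)` gives the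
  -- constants.
  refine ⟨WVI.machine, K * (2 * K + 2 * B + 4), 2 * (2 * D + 1), 2 * D + 1, fun I => ?_⟩
  obtain ⟨σ, s, hrun, hs, hσ⟩ := h I
  obtain ⟨-, t, ht, hts⟩ := hrun.run (I.size + B) (I.input_below.mono (by omega))
    (Nat.lt_two_pow_self.trans_le (Nat.pow_le_pow_right two_pos (by omega)))
  refine ⟨σ, t, ht, hts.trans ?_, hσ⟩
  set x := 2 ^ (2 * I.vc) * I.size with hx
  have hsize : I.size ≤ x := Nat.le_mul_of_pos_left _ (by positivity)
  have hx1 : 1 ≤ x := I.size_pos.trans_le hsize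
  have hxD : x ^ D ≤ x ^ (D + 1) := Nat.pow_le_pow_right hx1 (by omega)
  have hxD' : x ≤ x ^ (D + 1) := Nat.le_self_pow (by omega) _
  have hright : K * (2 * K + 2 * B + 4) * 2 ^ (2 * (2 * D + 1) * I.vc) * I.size ^ (2 * D + 1) =
      K * x ^ D * ((2 * K + 2 * B + 4) * x ^ (D + 1)) := by
    rw [hx, mul_pow, mul_pow, ← pow_mul, ← pow_mul]
    ring
  beta_reduce
  rw [hright]
  refine Nat.mul_le_mul hs ?_
  have h1 : K * x ^ D ≤ K * x ^ (D + 1) := Nat.mul_le_mul_left _ hxD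
  have h2 : B ≤ B * x ^ (D + 1) := Nat.le_mul_of_pos_right _ (by positivity)
  nlinarith
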